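/- Let $E$ be a locally compact separable metric space, $m$ a $\sigma$-finite Radon measure on $E$ with full support, $(\mathcal E,\mathcal F)$ a regular symmetric Dirichlet form on $L^2(E;m)$, and $(P_t)_{t\ge 0}$ the symmetric Markov semigroup associated with it, i.e. the one whose $L^2$-generator $\mathcal L$ is given by: $u\in\mathcal D(\mathcal L)$ and $\mathcal Lu=g$ iff $u\in\mathcal F$ and $\mathcal E(u,v)=-\int g v\,dm$ for all $v\in\mathcal F$. (The form may have killing.) Let $\mathcal F_b$ be the set of bounded elements of $\mathcal F$. Nash inequality. Let $\delta\ge 0$ and let $\theta:(0,\infty)\to(0,\infty)$ be measurable with $$\theta(\|f\|_2^2)\le \mathcal E(f,f)+\delta\|f\|_2^2\qquad\text{for all } f\in\mathcal F,\ f\ne 0,\ \|f\|_1\le 1,$$ and such that, for constants $c_1,c_2\ge 1$, $\lambda_0\ge 2$ and positive functions $c(\cdot),C(\cdot)$ on $(\lambda_0,\infty)$: (i) $\int_a^\infty ds/\theta(s)<\infty$ for some $a>0$; (ii) there is a nondecreasing $\theta_*$ on $(0,\infty)$ with $\theta_*(r)/r$ nondecreasing and $c_1^{-1}\theta_*(c_2^{-1}r)\le\theta(r)\le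 c_1\theta_*(c_2r)$ for all $r>0$; (iii) with $\varphi$ the inverse function of $r\mapsto\int_r^\infty ds/\theta(s)$ on $(0,\infty)$, for all $\lambda>\lambda_0$ and $t>0$, $$\prod_{k=1}^\infty\big(\varphi((\lambda-1)\lambda^{-(k+1)}t)\big)^{2^{-k}}\le C(\lambda)\,\varphi(c(\lambda)t).$$ Admissible functions. Let $C_0>0$, $C\ge 1$, $\eta>0$, and let $\phi(C_0,\cdot,\cdot)$ be a nonnegative function on $\mathcal F_b\times[1,\infty)$ such that, for all $\psi\in\mathcal F_b$, $\phi(C_0,-\psi,r)=\phi(C_0,\psi,r)$ for $r\ge1$, $r\mapsto\phi(C_0,\psi,r)$ is nondecreasing, and $\phi(C_0,\psi,R)\le C(R/r)^\eta\phi(C_0,\psi,r)$ for $1\le r\le R$. Let $\mathcal A(C_0;\phi,C,\eta)$ be the set of $\psi\in\mathcal F_b$ such that both $\chi=\psi$ and $\chi=-\psi$ satisfy $$\mathcal E(e^{\chi}f^{2p-1},e^{-\chi}f)\ge\frac{C_0}{p}\,\mathcal E(f^p,f^p)-\phi(C_0,\chi,p)\,\|f\|_{2p}^{2p}\qquad\text{for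 all real } p\ge1\text{ and all nonnegative } f\in\mathcal F_b.$$ Claim. For every $\varepsilon>0$ there are a constant $C_\varepsilon>0$ depending only on $c_1,c_2,\lambda_0,c(\cdot),C(\cdot),C,\eta,\varepsilon$, and a constant $c_\varepsilon>0$ depending only on these and on $C_0$, such that for every $\psi\in\mathcal A(C_0;\phi,C,\eta)$ and every $t>0$ the perturbed operator $P_t^\psi f=e^{\psi}P_t(e^{-\psi}f)$ (with $P_t$ extended to $L^1(E;m)$) is bounded from $L^1(E;m)$ to $L^\infty(E;m)$ and $$\|P_t^\psi\|_{1\to\infty}\le C_\varepsilon\,\varphi(c_\varepsilon t)\,e^{\delta t}\exp\big((1+\varepsilon)\,\phi(C_0,\psi,1)\,t\big).$$ -/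

import Mathlib

open MeasureTheory Filter Topology Set

noncomputable section

namespace OffDiag

variable {E : Type*} [MeasurableSpace E]

/-- A symmetric Dirichlet form `(form, dom)` on `L²(E; m)`: a nonnegative symmetric bilinear form
on a linear subspace of `L²`, complete for the norm
`form u u + ‖u‖²`, and Markovian (the unit contraction operates). -/
structure DirichletForm (m : Measure E) where
  dom : Submodule ℝ (Lp ℝ 2 m)
  form : dom →ₗ[ℝ] dom →ₗ[ℝ] ℝ
  symm : ∀ u v : dom, form u v = form v u
  nonneg : ∀ u : dom, 0 ≤ form u u
  complete : ∀ u : ℕ → dom,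
    (∀ r > 0, ∃ N, ∀ i ≥ N, ∀ j ≥ N, form (u i - u j) (u i - u j) + ‖u i - u j‖ ^ 2 < r) →
    ∃ v : dom, Tendsto (fun n => form (u n - v) (u n - v) + ‖u n - v‖ ^ 2) atTop (𝓝 0)
  markov : ∀ (u : dom) (v : Lp ℝ 2 m),
    (∀ᵐ x ∂m, v x = min (max 0 ((u : Lp ℝ 2 m) x)) 1) →
    ∃ hv : v ∈ dom, form ⟨v, hv⟩ ⟨v, hv⟩ ≤ form u u

namespace DirichletForm

variable {m : Measure E} (D : DirichletForm m)

/-- Regularity: the continuous compactly supported functions of the domain are dense in the domain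
for the norm `form u u + ‖u‖²`, and dense in `C_c(E)` for the uniform norm. -/
structure Regular [TopologicalSpace E] : Prop where
  dense_dom : ∀ (u : D.dom), ∀ r > 0, ∃ (g : E → ℝ) (v : D.dom),
    Continuous g ∧ HasCompactSupport g ∧ (v : Lp ℝ 2 m) =ᵐ[m] g ∧
      D.form (u - v) (u - v) + ‖u - v‖ ^ 2 < r
  dense_cc : ∀ g : E → ℝ, Continuous g → HasCompactSupport g → ∀ r > 0,
    ∃ (h : E → ℝ) (v : D.dom), Continuous h ∧ HasCompactSupport h ∧
      (v : Lp ℝ 2 m) =ᵐ[m] h ∧ ∀ x, |g x - h x| < r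

/-- The class of (essentially) bounded elements of the domain. -/
def bddDom : Set (Lp ℝ 2 m) :=
  {f | f ∈ D.dom ∧ ∃ K : ℝ, ∀ᵐ x ∂m, |f x| ≤ K}

/-- `L u = g` for the `L²`-generator `L` of the form: `u` is in the domain and
`form u v = - ∫ g v dm` for every `v` in the domain. -/
def IsGenerator (u g : Lp ℝ 2 m) : Prop :=
  ∃ hu : u ∈ D.dom, ∀ v : D.dom, D.form ⟨u, hu⟩ v = - ∫ x, g x * (v : Lp ℝ 2 m) x ∂m

/-- The Nash-type inequality
`θ (‖f‖₂²) ≤ form f f + δ ‖f‖₂²` for the `f ≠ 0` in the domain with `‖f‖₁ ≤ 1`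
(`θ` is a function on `(0, ∞)`). -/
def Nash (θ : ℝ → ℝ) (δ : ℝ) : Prop :=
  ∀ f : D.dom, f ≠ 0 → Integrable (f : Lp ℝ 2 m) m → ∫ x, |(f : Lp ℝ 2 m) x| ∂m ≤ 1 →
    θ (‖f‖ ^ 2) ≤ D.form f f + δ * ‖f‖ ^ 2

/-- The inequality
`form (e^ψ f^(2p-1)) (e^(-ψ) f) ≥ (C₀ / p) form (f^p) (f^p) - K(p) ‖f‖_{2p}^{2p}`
for all real `p ≥ 1` and all nonnegative bounded `f` in the domain. Here `u`, `v`, `w` are the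
`L²`-classes of the three functions `e^ψ f^(2p-1)`, `e^(-ψ) f`, `f^p`; these functions always
belong to the domain when `ψ` and `f` are bounded elements of it. -/
def DaviesBound (C₀ : ℝ) (K : ℝ → ℝ) (ψ : Lp ℝ 2 m) : Prop :=
  ∀ p : ℝ, 1 ≤ p → ∀ f ∈ D.bddDom, (∀ᵐ x ∂m, 0 ≤ f x) → ∀ u v w : D.dom,
    (∀ᵐ x ∂m, (u : Lp ℝ 2 m) x = Real.exp (ψ x) * f x ^ (2 * p - 1)) →
    (∀ᵐ x ∂m, (v : Lp ℝ 2 m) x = Real.exp (-ψ x) * f x) →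
    (∀ᵐ x ∂m, (w : Lp ℝ 2 m) x = f x ^ p) →
    C₀ / p * D.form w w - K p * ∫ x, f x ^ (2 * p) ∂m ≤ D.form u v

/-- The conditions on the rate function `Φ = φ(C₀, ·, ·)` on `bddDom × [1, ∞)`: nonnegative,
even in `ψ`, nondecreasing in `r`, and doubling in `r` uniformly in `ψ`, with constants `C`, `η`. -/
structure IsRate (Φ : Lp ℝ 2 m → ℝ → ℝ) (C η : ℝ) : Prop where
  nonneg : ∀ ψ ∈ D.bddDom, ∀ r : ℝ, 1 ≤ r → 0 ≤ Φ ψ r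
  even : ∀ ψ ∈ D.bddDom, ∀ r : ℝ, 1 ≤ r → Φ (-ψ) r = Φ ψ r
  mono : ∀ ψ ∈ D.bddDom, MonotoneOn (Φ ψ) (Ici 1)
  doubling : ∀ ψ ∈ D.bddDom, ∀ r R : ℝ, 1 ≤ r → r ≤ R → Φ ψ R ≤ C * (R / r) ^ η * Φ ψ r

/-- The class `𝒜(C₀; Φ, C, η)` of admissible functions. It is invariant under `ψ ↦ -ψ`: the
inequality is required for `ψ` and for `-ψ`, with the same rate. -/
def Admissible (C₀ : ℝ) (Φ : Lp ℝ 2 m → ℝ → ℝ) (C η : ℝ) : Set (Lp ℝ 2 m) :=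
  {ψ | ψ ∈ D.bddDom ∧ D.IsRate Φ C η ∧
    D.DaviesBound C₀ (Φ ψ) ψ ∧ D.DaviesBound C₀ (Φ (-ψ)) (-ψ)}

end DirichletForm

/-- A symmetric Markov semigroup on `L²(E; m)`: a strongly continuous semigroup of symmetric
contractions with `0 ≤ P_t f ≤ 1` whenever `0 ≤ f ≤ 1`. Only times `t ≥ 0` matter. -/
structure IsMarkovSemigroup {m : Measure E} (P : ℝ → Lp ℝ 2 m →L[ℝ] Lp ℝ 2 m) : Prop where
  zero : P 0 = ContinuousLinearMap.id ℝ (Lp ℝ 2 m)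
  add : ∀ s t, 0 ≤ s → 0 ≤ t → P (s + t) = (P s).comp (P t)
  contraction : ∀ t, 0 ≤ t → ‖P t‖ ≤ 1
  continuous : ∀ f, Tendsto (fun t => P t f) (𝓝[>] 0) (𝓝 f)
  symm : ∀ t, 0 ≤ t → ∀ f g, ∫ x, P t f x * g x ∂m = ∫ x, f x * P t g x ∂m
  markov : ∀ t, 0 ≤ t → ∀ f : Lp ℝ 2 m, (∀ᵐ x ∂m, 0 ≤ f x ∧ f x ≤ 1) →
    ∀ᵐ x ∂m, 0 ≤ P t f x ∧ P t f x ≤ 1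

/-- The semigroup is associated with the form: the infinitesimal generator of `P` on `L²` is the
`L²`-generator of the form. -/
def IsAssociated {m : Measure E} (D : DirichletForm m) (P : ℝ → Lp ℝ 2 m →L[ℝ] Lp ℝ 2 m) : Prop :=
  ∀ u g : Lp ℝ 2 m,
    Tendsto (fun t : ℝ => t⁻¹ • (P t u - u)) (𝓝[>] 0) (𝓝 g) ↔ D.IsGenerator u g

/-- `Q` is the (unique) bounded extension to `L¹` of an operator `S` on `L²`:
they agree on `L¹ ∩ L²`. -/
def IsL1Extension {m : Measure E} (S : Lp ℝ 2 m →L[ℝ] Lp ℝ 2 m)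
    (Q : Lp ℝ 1 m →L[ℝ] Lp ℝ 1 m) : Prop :=
  ∀ (f : Lp ℝ 2 m) (g : Lp ℝ 1 m), f =ᵐ[m] g → S f =ᵐ[m] Q g

/-- The bounded operator `T : L¹ → L^∞` is the perturbed operator `f ↦ e^ψ S (e^(-ψ) f)`, where `S`
acts on `L¹` through its bounded extension. -/
def IsPerturbed {m : Measure E} (S : Lp ℝ 2 m →L[ℝ] Lp ℝ 2 m) (ψ : Lp ℝ 2 m)
    (T : Lp ℝ 1 m →L[ℝ] Lp ℝ ⊤ m) : Prop :=
  ∃ Q : Lp ℝ 1 m →L[ℝ] Lp ℝ 1 m, IsL1Extension S Q ∧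
    ∀ f h : Lp ℝ 1 m, (∀ᵐ x ∂m, h x = Real.exp (-ψ x) * f x) →
      ∀ᵐ x ∂m, T f x = Real.exp (ψ x) * Q h x

/-- The inverse function on `(0, ∞)` of `r ↦ ∫_r^∞ 1 / θ(s) ds`. -/
def profile (θ : ℝ → ℝ) : ℝ → ℝ :=
  Function.invFunOn (fun r => ∫ s in Ioi r, 1 / θ s) (Ioi 0)

/-- The conditions on `θ : (0, ∞) → (0, ∞)`, with the constants that enter them. In `product`, the
infinite product is the limit of the partial products, which is required to exist (be finite);
`l₀` is the threshold beyond which `l` is large enough. -/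
structure ThetaConditions (θ : ℝ → ℝ) (c₁ c₂ l₀ : ℝ) (cl Cl : ℝ → ℝ) : Prop where
  pos : ∀ r > 0, 0 < θ r
  aemeasurable : AEMeasurable θ (volume.restrict (Ioi 0))
  integrable : ∃ a > 0, IntegrableOn (fun s => 1 / θ s) (Ioi a)
  comparison : ∃ θs : ℝ → ℝ, MonotoneOn θs (Ioi 0) ∧ MonotoneOn (fun r => θs r / r) (Ioi 0) ∧
    ∀ r > 0, c₁⁻¹ * θs (c₂⁻¹ * r) ≤ θ r ∧ θ r ≤ c₁ * θs (c₂ * r)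
  product : ∀ l > l₀, ∀ t > 0, ∃ L : ℝ,
    Tendsto (fun n : ℕ => ∏ k ∈ Finset.Icc 1 n,
      profile θ ((l - 1) * (l ^ (k + 1))⁻¹ * t) ^ ((1 : ℝ) / 2 ^ k)) atTop (𝓝 L) ∧
    L ≤ Cl l * profile θ (cl l * t)

end OffDiag

end

open OffDiag

/-! The proof is Davies' perturbation method combined with a Nash iteration along dyadic exponents.
For `g ≥ 0` put `u_r = e^ψ P_r g` and `V_p(r) = ∫ u_r^(2p) dm`. Testing the generator equation
against `e^ψ u^(2p-1)` and using admissibility gives `V_p' ≤ -2 C₀ 𝓔(u^p, u^p) + 2p K(p) V_p`, where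
`K = Φ ψ`. Dropping the energy controls the growth of every `L^(2p)` norm (`DaviesOrbit.growth`).
Keeping it, the Nash inequality for `u^p`, normalised by its `L¹` norm `V_{p/2}`, becomes `W' ≤ -2
C₀ θ(W)` for a renormalised `V_p`, so that `W(s) ≤ profile θ (2 C₀ s)` (`le_profile`). This is a
smoothing step from `L^p` to `L^(2p)` (`DaviesOrbit.nash_step`).

The steps are run at the exponents `2^(k+1)` over times `(l-1) l^(-(k+1)) T`. The profile factors
accumulate to the square root of the product in condition (iii). The rates satisfy `K(2^k) ≤ C
2^(ηk) K(1)`, so for `l` large the steps after the initial one cost at most `ε K(1) T`, while that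
one, spent in `L²`, costs at most `K(1) T`; this is the factor `1 + ε`. Letting the exponent tend to
infinity gives an `L² → L^∞` bound (`DaviesOrbit.ae_le`). Applied to `ψ` and `-ψ` at `T = t/2`, it
yields `L¹ → L² → L^∞` by duality, and the square roots multiply to the full product.

Two analytic points support this. The functions `e^ψ h`, `e^ψ (e^ψ h)^(2p-1)`, `(e^ψ h)^p` must lie
in the form domain: `IsAssociated.exists_comp` obtains this from the approximating forms `t⁻¹ ⟨x -
P_t x, x⟩`, which contract under Lipschitz maps by the Markov property. And the differential
inequalities need bounded data in the generator domain, which time averages of orbits of bounded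
functions provide. -/

noncomputable section

namespace OffDiag

/-! ### The rate function `θ`, its profile, and the choice of time steps. -/

section Profile

variable {θ : ℝ → ℝ} {c₁ c₂ l₀ : ℝ} {cl Cl : ℝ → ℝ}

/-- The comparison function is positive because it dominates `θ`, and its monotonicity then keeps
`θ` away from zero off the origin. This extends integrability of `1/θ` from one half-line to all of
them. -/
lemma ThetaConditions.exists_lower_bound (h : ThetaConditions θ c₁ c₂ l₀ cl Cl) (hc₁ : 1 ≤ c₁)
    (hc₂ : 1 ≤ c₂) {r : ℝ} (hr : 0 < r) : ∃ κ > 0, ∀ s ≥ r, κ ≤ θ s := by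
  obtain ⟨θs, hmono, -, hcomp⟩ := h.comparison
  have hc₁' : 0 < c₁ := by linarith
  have hc₂' : 0 < c₂ := by linarith
  have hpos : ∀ x > 0, 0 < θs x := by
    intro x hx
    have h1 := (hcomp (c₂⁻¹ * x) (by positivity)).2
    have h2 := h.pos (c₂⁻¹ * x) (by positivity)
    rw [mul_inv_cancel_left₀ hc₂'.ne'] at h1
    exact pos_of_mul_pos_right (h2.trans_le h1) hc₁'.le
  refine ⟨c₁⁻¹ * θs (c₂⁻¹ * r), mul_pos (by positivity) (hpos _ (by positivity)), fun s hs => ?_⟩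
  have hs' : 0 < s := lt_of_lt_of_le hr hs
  refine le_trans ?_ (hcomp s hs').1
  gcongr
  exact hmono (mem_Ioi.2 (by positivity)) (mem_Ioi.2 (by positivity)) (by gcongr)

/-- Monotonicity of `θ_*(r)/r` makes `θ` at most linear near zero, so `∫ ds/θ` diverges there and
the profile is defined at every positive time. -/
lemma ThetaConditions.exists_upper_bound (h : ThetaConditions θ c₁ c₂ l₀ cl Cl) (hc₁ : 1 ≤ c₁)
    (hc₂ : 1 ≤ c₂) : ∃ K > 0, ∀ s, 0 < s → s ≤ 1 → θ s ≤ K * s := by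
  obtain ⟨θs, -, hmono, hcomp⟩ := h.comparison
  have hc₁' : 0 < c₁ := by linarith
  have hc₂' : 0 < c₂ := by linarith
  have key : ∀ s, 0 < s → s ≤ 1 → θ s ≤ c₁ * θs c₂ * s := by
    intro s hs hs1
    have h1 := hmono (a := c₂ * s) (b := c₂) (mem_Ioi.2 (by positivity)) (mem_Ioi.2 hc₂')
      (by nlinarith)
    simp only at h1
    rw [div_le_div_iff₀ (by positivity) hc₂'] at h1
    have h2 : θs (c₂ * s) ≤ θs c₂ * s := by
      have : θs (c₂ * s) * c₂ ≤ (θs c₂ * s) * c₂ := by linarith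
      exact le_of_mul_le_mul_right this hc₂'
    calc θ s ≤ c₁ * θs (c₂ * s) := (hcomp s hs).2
      _ ≤ c₁ * (θs c₂ * s) := by gcongr
      _ = _ := by ring
  refine ⟨c₁ * θs c₂, ?_, key⟩
  have := key 1 one_pos le_rfl
  have := h.pos 1 one_pos
  linarith

lemma ThetaConditions.integrableOn_Ioi (h : ThetaConditions θ c₁ c₂ l₀ cl Cl) (hc₁ : 1 ≤ c₁)
    (hc₂ : 1 ≤ c₂) {r : ℝ} (hr : 0 < r) : IntegrableOn (fun s => 1 / θ s) (Ioi r) := by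
  obtain ⟨a, ha, hint⟩ := h.integrable
  obtain ⟨κ, hκ, hbd⟩ := h.exists_lower_bound hc₁ hc₂ hr
  have hmeas : AEStronglyMeasurable (fun s => 1 / θ s) (volume.restrict (Ioc r a)) := by
    have h1 : AEMeasurable θ (volume.restrict (Ioc r a)) :=
      h.aemeasurable.mono_measure (Measure.restrict_mono (fun x hx => hr.trans hx.1) le_rfl)
    exact (aemeasurable_const.div h1).aestronglyMeasurable
  have h1 : IntegrableOn (fun s => 1 / θ s) (Ioc r a) := by
    refine Integrable.of_bound (C := 1 / κ) hmeas ?_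
    refine (ae_restrict_iff' measurableSet_Ioc).2 (ae_of_all _ fun x hx => ?_)
    have := hbd x hx.1.le
    rw [Real.norm_of_nonneg (one_div_nonneg.2 (hκ.le.trans this))]
    exact one_div_le_one_div_of_le hκ this
  refine (h1.union hint).mono_set fun x hx => ?_
  by_cases hxa : x ≤ a
  · exact Or.inl ⟨hx, hxa⟩
  · exact Or.inr (not_le.1 hxa)

lemma ThetaConditions.integral_Ioi_sub (h : ThetaConditions θ c₁ c₂ l₀ cl Cl) (hc₁ : 1 ≤ c₁)
    (hc₂ : 1 ≤ c₂) {r r' : ℝ} (hr : 0 < r) (hrr' : r ≤ r') :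
    (∫ s in Ioi r, 1 / θ s) = (∫ s in Ioc r r', 1 / θ s) + ∫ s in Ioi r', 1 / θ s := by
  have hint := h.integrableOn_Ioi hc₁ hc₂ hr
  rw [← Ioc_union_Ioi_eq_Ioi hrr']
  exact setIntegral_union (Ioc_disjoint_Ioi le_rfl) measurableSet_Ioi
    (hint.mono_set Ioc_subset_Ioi_self) (hint.mono_set (Ioi_subset_Ioi hrr'))

lemma ThetaConditions.strictAntiOn (h : ThetaConditions θ c₁ c₂ l₀ cl Cl) (hc₁ : 1 ≤ c₁)
    (hc₂ : 1 ≤ c₂) : StrictAntiOn (fun r => ∫ s in Ioi r, 1 / θ s) (Ioi 0) := by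
  intro r hr r' _ hrr'
  have hint := h.integrableOn_Ioi hc₁ hc₂ hr
  have h1 := h.integral_Ioi_sub hc₁ hc₂ hr hrr'.le
  have h2 : 0 < ∫ s in Ioc r r', 1 / θ s := by
    rw [← intervalIntegral.integral_of_le hrr'.le]
    refine intervalIntegral.intervalIntegral_pos_of_pos_on ?_ (fun x hx => ?_) hrr'
    · exact (intervalIntegrable_iff_integrableOn_Ioc_of_le hrr'.le).2
        (hint.mono_set Ioc_subset_Ioi_self)
    · exact one_div_pos.2 (h.pos x ((mem_Ioi.1 hr).trans hx.1))
  simp only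
  linarith

lemma ThetaConditions.exists_eq (h : ThetaConditions θ c₁ c₂ l₀ cl Cl) (hc₁ : 1 ≤ c₁)
    (hc₂ : 1 ≤ c₂) {y : ℝ} (hy : 0 < y) : ∃ r > 0, ∫ s in Ioi r, 1 / θ s = y := by
  set H : ℝ → ℝ := fun r => ∫ s in Ioi r, 1 / θ s with hH
  have hcont : ContinuousOn H (Ioi 0) := by
    intro x hx
    have hx2 : 0 < x / 2 := half_pos hx
    have hint := h.integrableOn_Ioi hc₁ hc₂ hx2
    have h1 : ContinuousOn (fun r => ∫ s in Ioc (x / 2) r, 1 / θ s) (Icc (x / 2) (2 * x)) :=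
      intervalIntegral.continuousOn_primitive
        ((integrableOn_Icc_iff_integrableOn_Ioc (by simp)).2 (hint.mono_set Ioc_subset_Ioi_self))
    have hx' := mem_Ioi.1 hx
    have hnhds : Icc (x / 2) (2 * x) ∈ 𝓝 x := Icc_mem_nhds (by linarith) (by linarith)
    have h2 : ContinuousAt (fun r => H (x / 2) - ∫ s in Ioc (x / 2) r, 1 / θ s) x :=
      continuousAt_const.sub (h1.continuousAt hnhds)
    refine (h2.congr ?_).continuousWithinAt
    filter_upwards [hnhds] with r hr
    have := h.integral_Ioi_sub hc₁ hc₂ hx2 hr.1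
    simp only [hH]
    linarith
  have htop : ∃ b > 0, H b < y := by
    have h1 : Tendsto (fun b => ∫ s in (1 : ℝ)..b, 1 / θ s) atTop (𝓝 (H 1)) :=
      intervalIntegral_tendsto_integral_Ioi 1 (h.integrableOn_Ioi hc₁ hc₂ one_pos) tendsto_id
    have h2 := h1.eventually (lt_mem_nhds (show H 1 - y < H 1 by linarith))
    obtain ⟨b, hb, hb1⟩ := (h2.and (eventually_ge_atTop 1)).exists
    refine ⟨b, by linarith, ?_⟩
    have := h.integral_Ioi_sub hc₁ hc₂ one_pos hb1
    rw [intervalIntegral.integral_of_le hb1] at hb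
    simp only [hH] at *
    linarith
  have hbot : ∃ a > 0, y < H a := by
    obtain ⟨K, hK, hbd⟩ := h.exists_upper_bound hc₁ hc₂
    -- Chosen so that `∫_a^1 ds/(K s) = y`.
    set a : ℝ := Real.exp (-(K * y)) with ha
    have ha0 : 0 < a := Real.exp_pos _
    have ha1 : a ≤ 1 := Real.exp_le_one_iff.2 (by nlinarith)
    refine ⟨a, ha0, ?_⟩
    have hsub := h.integral_Ioi_sub hc₁ hc₂ ha0 ha1
    have hint := h.integrableOn_Ioi hc₁ hc₂ ha0
    have hH1 : 0 < H 1 := by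
      have h2 := h.strictAntiOn hc₁ hc₂ (mem_Ioi.2 one_pos) (mem_Ioi.2 two_pos) one_lt_two
      have h3 : 0 ≤ H 2 := setIntegral_nonneg measurableSet_Ioi fun x hx =>
        one_div_nonneg.2 (h.pos x (two_pos.trans hx)).le
      exact lt_of_le_of_lt h3 h2
    have h3 : y ≤ ∫ s in Ioc a 1, 1 / θ s := by
      rw [← intervalIntegral.integral_of_le ha1]
      have h4 : ∫ s in a..1, K⁻¹ * s⁻¹ = y := by
        rw [intervalIntegral.integral_const_mul, integral_inv_of_pos ha0 one_pos, one_div,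
          Real.log_inv, ha, Real.log_exp]
        field_simp
      rw [← h4]
      refine intervalIntegral.integral_mono_on ha1 ?_ ?_ fun x hx => ?_
      · refine ContinuousOn.intervalIntegrable ?_
        rw [uIcc_of_le ha1]
        exact continuousOn_const.mul (continuousOn_id.inv₀ fun x hx => (ha0.trans_le hx.1).ne')
      · exact (intervalIntegrable_iff_integrableOn_Ioc_of_le ha1).2
          (hint.mono_set Ioc_subset_Ioi_self)
      · have hx0 := ha0.trans_le hx.1
        have := h.pos x hx0
        rw [← mul_inv, one_div]
        exact inv_anti₀ this (hbd x hx0 hx.2)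
    simp only [hH] at *
    linarith
  obtain ⟨b, hb, hb'⟩ := htop
  obtain ⟨a, ha, ha'⟩ := hbot
  have hpre : IsPreconnected (Ioi (0 : ℝ)) := isPreconnected_Ioi
  obtain ⟨r, hr, hry⟩ := hpre.intermediate_value (mem_Ioi.2 hb) (mem_Ioi.2 ha) hcont
    ⟨hb'.le, ha'.le⟩
  exact ⟨r, hr, hry⟩

lemma ThetaConditions.profile_spec (h : ThetaConditions θ c₁ c₂ l₀ cl Cl) (hc₁ : 1 ≤ c₁)
    (hc₂ : 1 ≤ c₂) {y : ℝ} (hy : 0 < y) :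
    0 < profile θ y ∧ ∫ s in Ioi (profile θ y), 1 / θ s = y := by
  obtain ⟨r, hr, hry⟩ := h.exists_eq hc₁ hc₂ hy
  have hex : ∃ a ∈ Ioi (0 : ℝ), (fun r => ∫ s in Ioi r, 1 / θ s) a = y := ⟨r, hr, hry⟩
  exact ⟨Function.invFunOn_mem hex, Function.invFunOn_eq hex⟩

/-- A positive solution of `W' ≤ -κ θ(W)` lies below the profile of `θ`. -/
lemma ThetaConditions.le_profile (h : ThetaConditions θ c₁ c₂ l₀ cl Cl) (hc₁ : 1 ≤ c₁)
    (hc₂ : 1 ≤ c₂) {W W' : ℝ → ℝ} {κ s : ℝ} (hκ : 0 < κ) (hs : 0 < s)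
    (hW : ContinuousOn W (Icc 0 s)) (hpos : ∀ r ∈ Icc 0 s, 0 < W r)
    (hderiv : ∀ r ∈ Ioo 0 s, HasDerivAt W (W' r) r)
    (hle : ∀ r ∈ Ioo 0 s, W' r ≤ -(κ * θ (W r))) : W s ≤ profile θ (κ * s) := by
  have hneg : ∀ r ∈ Ioo 0 s, W' r < 0 := fun r hr => by
    have := h.pos _ (hpos r (Ioo_subset_Icc_self hr))
    have := hle r hr
    nlinarith
  have hanti : StrictAntiOn W (Icc 0 s) := by
    refine strictAntiOn_of_deriv_neg (convex_Icc 0 s) hW fun x hx => ?_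
    rw [interior_Icc] at hx
    rw [(hderiv x hx).deriv]
    exact hneg x hx
  have hWs : 0 < W s := hpos s (right_mem_Icc.2 hs.le)
  -- Change of variables `y = W(r)` in `∫ dy/θ(y)`, with `|W'|/θ(W) ≥ κ`. Lower integrals are used
  -- so that no regularity of `W'` is needed.
  have hkey : κ * s ≤ ∫ r in Ioi (W s), 1 / θ r := by
    have hint := h.integrableOn_Ioi hc₁ hc₂ hWs
    have hnn : 0 ≤ᵐ[volume.restrict (Ioi (W s))] fun r => 1 / θ r :=
      (ae_restrict_iff' measurableSet_Ioi).2 (ae_of_all _ fun x hx =>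
        one_div_nonneg.2 (h.pos x (hWs.trans hx)).le)
    have h0 : 0 ≤ ∫ r in Ioi (W s), 1 / θ r := integral_nonneg_of_ae hnn
    rw [← ENNReal.ofReal_le_ofReal_iff h0, ofReal_integral_eq_lintegral_ofReal hint hnn]
    have himg : W '' Ioo 0 s ⊆ Ioi (W s) := by
      rintro _ ⟨r, hr, rfl⟩
      exact hanti (Ioo_subset_Icc_self hr) (right_mem_Icc.2 hs.le) hr.2
    calc ENNReal.ofReal (κ * s) = ∫⁻ _ in Ioo 0 s, ENNReal.ofReal κ := by
          rw [setLIntegral_const, Real.volume_Ioo, sub_zero, ENNReal.ofReal_mul hκ.le]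
      _ ≤ ∫⁻ r in Ioo 0 s, ENNReal.ofReal |W' r| * ENNReal.ofReal (1 / θ (W r)) := by
          refine setLIntegral_mono' measurableSet_Ioo fun r hr => ?_
          rw [← ENNReal.ofReal_mul (abs_nonneg _)]
          refine ENNReal.ofReal_le_ofReal ?_
          have h1 := h.pos _ (hpos r (Ioo_subset_Icc_self hr))
          rw [mul_one_div, le_div_iff₀ h1, abs_of_neg (hneg r hr)]
          linarith [hle r hr]
      _ = ∫⁻ y in W '' Ioo 0 s, ENNReal.ofReal (1 / θ y) :=
          (lintegral_image_eq_lintegral_abs_deriv_mul measurableSet_Ioo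
            (fun r hr => (hderiv r hr).hasDerivWithinAt)
            (hanti.injOn.mono Ioo_subset_Icc_self) fun y => ENNReal.ofReal (1 / θ y)).symm
      _ ≤ _ := lintegral_mono_set himg
  obtain ⟨hp, hpe⟩ := h.profile_spec hc₁ hc₂ (mul_pos hκ hs)
  by_contra! hlt
  have := h.strictAntiOn hc₁ hc₂ (mem_Ioi.2 hp) (mem_Ioi.2 hWs) hlt
  simp only at this
  linarith

end Profile

/-- Geometric choice of the time steps: the rates along the dyadic exponents add up to at most
`ε` times the initial rate. -/
lemma exists_step_ratio (C η ε l₀ : ℝ) (hC : 1 ≤ C) (hε : 0 < ε) (hl₀ : 2 ≤ l₀) :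
    ∃ l > l₀, ∀ n : ℕ, ∑ j ∈ Finset.Icc 1 n, C * ((2 : ℝ) ^ η / l) ^ j ≤ ε := by
  have h2 : 0 < (2 : ℝ) ^ η := by positivity
  -- With `q = 2^η/l` this forces `q (1 + C/ε) ≤ 1`, that is `C q/(1 - q) ≤ ε`, the bound for the
  -- whole geometric series.
  set l := l₀ + (2 : ℝ) ^ η * (1 + C / ε) with hl
  have hCε : 0 < C / ε := by positivity
  have hl0 : 0 < l := by positivity
  refine ⟨l, by rw [hl]; nlinarith, fun n => ?_⟩
  set q := (2 : ℝ) ^ η / l with hq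
  have hq0 : 0 < q := by positivity
  have hql : q * (1 + C / ε) ≤ 1 := by
    rw [hq, div_mul_eq_mul_div, div_le_one hl0]
    linarith
  have hq1 : q < 1 := by nlinarith
  have hCq : C * q ≤ ε * (1 - q) := by
    have : ε * (q * (1 + C / ε)) ≤ ε * 1 := by gcongr
    have h3 : ε * (q * (1 + C / ε)) = ε * q + C * q := by field_simp
    linarith
  have hgeom : ∀ n : ℕ, ∑ j ∈ Finset.Icc 1 n, C * q ^ j ≤ ε * (1 - q ^ n) := by
    intro n
    induction n with
    | zero => simp
    | succ n ih =>
      rw [Finset.sum_Icc_succ_top (by omega)]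
      have : C * q ^ (n + 1) ≤ ε * (1 - q) * q ^ n := by
        have := mul_le_mul_of_nonneg_right hCq (pow_nonneg hq0.le n)
        calc C * q ^ (n + 1) = C * q * q ^ n := by ring
          _ ≤ _ := this
      calc _ ≤ ε * (1 - q ^ n) + ε * (1 - q) * q ^ n := add_le_add ih this
        _ = _ := by ring
  refine (hgeom n).trans ?_
  have : 0 ≤ q ^ n := by positivity
  nlinarith

end OffDiag

namespace OffDiag

/-! ### Orbit means and the approximating forms. -/

section Semigroup

variable {E : Type*} [MeasurableSpace E] {m : Measure E}

lemma inner_eq_integral (f g : Lp ℝ 2 m) : inner ℝ f g = ∫ x, f x * g x ∂m := by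
  rw [L2.inner_def]
  exact integral_congr_ae (ae_of_all _ fun x => by simp [mul_comm])

variable {P : ℝ → Lp ℝ 2 m →L[ℝ] Lp ℝ 2 m}

namespace IsMarkovSemigroup

lemma inner_apply_left (hP : IsMarkovSemigroup P) {t : ℝ} (ht : 0 ≤ t) (f g : Lp ℝ 2 m) :
    inner ℝ (P t f) g = inner ℝ f (P t g) := by
  rw [inner_eq_integral, inner_eq_integral, hP.symm t ht]

lemma norm_apply_le (hP : IsMarkovSemigroup P) {t : ℝ} (ht : 0 ≤ t) (f : Lp ℝ 2 m) :
    ‖P t f‖ ≤ ‖f‖ := by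
  simpa using (P t).le_of_opNorm_le (hP.contraction t ht) f

lemma apply_apply (hP : IsMarkovSemigroup P) {s t : ℝ} (hs : 0 ≤ s) (ht : 0 ≤ t)
    (f : Lp ℝ 2 m) : P s (P t f) = P (s + t) f := by
  rw [hP.add s t hs ht]; rfl

lemma zero_apply (hP : IsMarkovSemigroup P) (f : Lp ℝ 2 m) : P 0 f = f := by
  rw [hP.zero]; rfl

lemma comm (hP : IsMarkovSemigroup P) {s t : ℝ} (hs : 0 ≤ s) (ht : 0 ≤ t)
    (f : Lp ℝ 2 m) : P s (P t f) = P t (P s f) := by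
  rw [hP.apply_apply hs ht, hP.apply_apply ht hs, add_comm]

lemma tendsto_zero (hP : IsMarkovSemigroup P) (f : Lp ℝ 2 m) :
    Tendsto (fun t => P t f) (𝓝[≥] 0) (𝓝 f) := by
  have h : insert (0 : ℝ) (Ioi 0) = Ici 0 := Ioi_insert
  rw [← h, nhdsWithin_insert, tendsto_sup]
  refine ⟨?_, hP.continuous f⟩
  have := tendsto_pure_nhds (fun t => P t f) 0
  rwa [hP.zero_apply] at this

lemma norm_sub_le (hP : IsMarkovSemigroup P) {s t : ℝ} (hs : 0 ≤ s) (ht : 0 ≤ t)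
    (f : Lp ℝ 2 m) : ‖P s f - P t f‖ ≤ ‖P |s - t| f - f‖ := by
  wlog hst : t ≤ s generalizing s t
  · rw [norm_sub_rev, abs_sub_comm]
    exact this ht hs (le_of_not_ge hst)
  have h0 : 0 ≤ s - t := sub_nonneg.2 hst
  have h1 : P s f - P t f = P t (P (s - t) f - f) := by
    rw [map_sub, hP.apply_apply ht h0, add_sub_cancel]
  rw [h1, abs_of_nonneg h0]
  exact hP.norm_apply_le ht _

lemma continuous_path (hP : IsMarkovSemigroup P) (f : Lp ℝ 2 m) :
    Continuous fun s : ℝ => P (max s 0) f := by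
  refine continuous_iff_continuousAt.2 fun t => ?_
  rw [ContinuousAt, tendsto_iff_norm_sub_tendsto_zero]
  have h1 : Tendsto (fun s : ℝ => |max s 0 - max t 0|) (𝓝 t) (𝓝[≥] 0) := by
    refine tendsto_nhdsWithin_iff.2 ⟨?_, Eventually.of_forall fun s => mem_Ici.2 (abs_nonneg _)⟩
    have : Continuous fun s : ℝ => |max s 0 - max t 0| := by fun_prop
    simpa using this.tendsto t
  have h2 := (tendsto_iff_norm_sub_tendsto_zero.1 (hP.tendsto_zero f)).comp h1
  exact squeeze_zero (fun _ => norm_nonneg _)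
    (fun s => hP.norm_sub_le (le_max_right _ _) (le_max_right _ _) f) h2

lemma inner_sub_nonneg (hP : IsMarkovSemigroup P) {a : ℝ} (ha : 0 ≤ a) (x : Lp ℝ 2 m) :
    0 ≤ inner ℝ (x - P a x) x := by
  rw [inner_sub_left, real_inner_self_eq_norm_sq, sub_nonneg]
  calc inner ℝ (P a x) x ≤ ‖P a x‖ * ‖x‖ := real_inner_le_norm _ _
    _ ≤ ‖x‖ * ‖x‖ := by gcongr; exact hP.norm_apply_le ha x
    _ = _ := (sq _).symm

/-- Replaces the spectral theorem: `n ↦ ⟨x - P_a x, P_{nb} x⟩` is convex, its second difference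
being the nonnegative `⟨(1 - P_a)(1 - P_b)² P_{nb} x, x⟩`. A convex sequence bounded above is
nonincreasing. -/
lemma inner_sub_apply_le (hP : IsMarkovSemigroup P) {a b : ℝ} (ha : 0 ≤ a) (hb : 0 ≤ b)
    (x : Lp ℝ 2 m) : inner ℝ (x - P a x) (P b x) ≤ inner ℝ (x - P a x) x := by
  set w := x - P a x with hw
  set y : ℕ → ℝ := fun n => inner ℝ w (P (n * b) x) with hy
  have hconv : ∀ n : ℕ, y (n + 1) - y n ≤ y (n + 2) - y (n + 1) := by
    intro n
    have hnb : 0 ≤ (n : ℝ) * b / 2 := by positivity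
    have key := hP.inner_sub_nonneg ha (P (n * b / 2) (x - P b x))
    have e1 : P (n * b / 2) (x - P b x) - P a (P (n * b / 2) (x - P b x))
        = P (n * b / 2) (w - P b w) := by
      simp only [hw, map_sub]
      rw [hP.comm ha hnb x, hP.comm ha hnb (P b x), hP.comm hb ha x]
      abel
    have e2 : P (n * b / 2) (P (n * b / 2) (x - P b x)) = P (n * b) x - P ((n + 1) * b) x := by
      rw [hP.apply_apply hnb hnb, map_sub, hP.apply_apply (by positivity) hb]
      ring_nf
    have e3 : P b (P (n * b) x - P ((n + 1) * b) x) = P ((n + 1) * b) x - P ((n + 2) * b) x := by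
      rw [map_sub, hP.apply_apply hb (by positivity), hP.apply_apply hb (by positivity)]
      ring_nf
    rw [e1, hP.inner_apply_left hnb, e2, inner_sub_left, hP.inner_apply_left hb, e3] at key
    simp only [inner_sub_right] at key
    simp only [hy]
    push_cast
    linarith
  have hinc : ∀ n : ℕ, y 1 - y 0 ≤ y (n + 1) - y n := by
    intro n
    induction n with
    | zero => exact le_rfl
    | succ n ih => exact ih.trans (hconv n)
  have hgrow : ∀ n : ℕ, y 0 + n * (y 1 - y 0) ≤ y n := by
    intro n
    induction n with
    | zero => simp
    | succ n ih =>
      have := hinc n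
      push_cast
      linarith
  have hbdd : ∀ n : ℕ, y n ≤ ‖w‖ * ‖x‖ := fun n =>
    (real_inner_le_norm _ _).trans
      (mul_le_mul_of_nonneg_left (hP.norm_apply_le (by positivity) x) (norm_nonneg _))
  have h01 : y 1 ≤ y 0 := by
    by_contra! hlt
    obtain ⟨n, hn⟩ := exists_nat_gt ((‖w‖ * ‖x‖ - y 0) / (y 1 - y 0))
    rw [div_lt_iff₀ (by linarith)] at hn
    have := hgrow n
    have := hbdd n
    linarith
  simpa [hy, hP.zero_apply] using h01

lemma antitoneOn_inner (hP : IsMarkovSemigroup P) {a : ℝ} (ha : 0 ≤ a) (x : Lp ℝ 2 m)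
    {s t : ℝ} (hs : 0 ≤ s) (hst : s ≤ t) :
    inner ℝ (x - P a x) (P t x) ≤ inner ℝ (x - P a x) (P s x) := by
  have hs2 : 0 ≤ s / 2 := by positivity
  have hts : 0 ≤ t - s := sub_nonneg.2 hst
  have key := hP.inner_sub_apply_le ha hts (P (s / 2) x)
  rw [hP.comm ha hs2, ← map_sub, hP.inner_apply_left hs2, hP.inner_apply_left hs2,
    hP.apply_apply hts hs2, hP.apply_apply hs2 (by positivity), hP.apply_apply hs2 hs2] at key
  convert! key using 3
  · ring_nf
  · ring_nf

end IsMarkovSemigroup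

/-- The mean of the orbit of `x` over the time interval `[0, a]`. -/
def orbitMean (P : ℝ → Lp ℝ 2 m →L[ℝ] Lp ℝ 2 m) (a : ℝ) (x : Lp ℝ 2 m) : Lp ℝ 2 m :=
  a⁻¹ • ∫ s in (0 : ℝ)..a, P (max s 0) x

namespace IsMarkovSemigroup

lemma hasDerivAt_integral_path (hP : IsMarkovSemigroup P) (x : Lp ℝ 2 m) (b : ℝ) :
    HasDerivAt (fun t => ∫ s in (0 : ℝ)..t, P (max s 0) x) (P (max b 0) x) b :=
  intervalIntegral.integral_hasDerivAt_right ((hP.continuous_path x).intervalIntegrable _ _)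
    ((hP.continuous_path x).stronglyMeasurableAtFilter _ _) (hP.continuous_path x).continuousAt

lemma tendsto_orbitMean (hP : IsMarkovSemigroup P) (x : Lp ℝ 2 m) :
    Tendsto (fun a => orbitMean P a x) (𝓝[>] 0) (𝓝 x) := by
  have h := (hP.hasDerivAt_integral_path x 0).tendsto_slope_zero_right
  simpa [orbitMean, hP.zero_apply] using h

lemma inner_orbitMean (hP : IsMarkovSemigroup P) (a : ℝ) (x y : Lp ℝ 2 m) :
    inner ℝ y (orbitMean P a x) = a⁻¹ * ∫ s in (0 : ℝ)..a, inner ℝ y (P (max s 0) x) := by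
  rw [orbitMean, inner_smul_right]
  congr 1
  exact ((innerSL ℝ y).intervalIntegral_comp_comm
    ((hP.continuous_path x).intervalIntegrable 0 a)).symm

lemma inner_sub_orbitMean_anti (hP : IsMarkovSemigroup P) {a b c : ℝ} (ha : 0 ≤ a) (hb : 0 < b)
    (hbc : b ≤ c) (x : Lp ℝ 2 m) :
    inner ℝ (x - P a x) (orbitMean P c x) ≤ inner ℝ (x - P a x) (orbitMean P b x) := by
  have hc : 0 < c := hb.trans_le hbc
  set G : ℝ → ℝ := fun s => inner ℝ (x - P a x) (P (max s 0) x) with hG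
  have hcont : Continuous G := continuous_const.inner (hP.continuous_path x)
  -- Rescaling both means to `[0, 1]` allows a pointwise comparison of the integrands.
  have hcv : ∀ d : ℝ, 0 < d → d⁻¹ * ∫ s in (0 : ℝ)..d, G s = ∫ r in (0 : ℝ)..1, G (d * r) := by
    intro d hd
    rw [intervalIntegral.integral_comp_mul_left G hd.ne']
    simp
  rw [hP.inner_orbitMean, hP.inner_orbitMean, hcv b hb, hcv c hc]
  refine intervalIntegral.integral_mono_on zero_le_one
    ((hcont.comp (continuous_const.mul continuous_id)).intervalIntegrable _ _)
    ((hcont.comp (continuous_const.mul continuous_id)).intervalIntegrable _ _) fun r hr => ?_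
  refine hP.antitoneOn_inner ha x (le_max_right _ _) (max_le_max_right _ ?_)
  exact mul_le_mul_of_nonneg_right hbc hr.1

lemma inner_sub_orbitMean_le (hP : IsMarkovSemigroup P) {a c : ℝ} (ha : 0 ≤ a) (hc : 0 < c)
    (x : Lp ℝ 2 m) :
    inner ℝ (x - P a x) (orbitMean P c x) ≤ inner ℝ (x - P a x) x := by
  have h1 : Tendsto (fun b => inner ℝ (x - P a x) (orbitMean P b x)) (𝓝[>] 0)
      (𝓝 (inner ℝ (x - P a x) x)) := tendsto_const_nhds.inner (hP.tendsto_orbitMean x)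
  refine ge_of_tendsto h1 ?_
  filter_upwards [Ioc_mem_nhdsGT hc] with b hb
  exact hP.inner_sub_orbitMean_anti ha hb.1 hb.2 x

/-- `P_t` shifts the interval of integration, so only its two end pieces survive in the difference
quotient. Orbit means thus supply elements of the generator domain. -/
lemma tendsto_generator_orbitMean (hP : IsMarkovSemigroup P) {a : ℝ} (ha : 0 < a)
    (x : Lp ℝ 2 m) :
    Tendsto (fun t : ℝ => t⁻¹ • (P t (orbitMean P a x) - orbitMean P a x)) (𝓝[>] 0)
      (𝓝 (a⁻¹ • (P a x - x))) := by
  have h0 := (hP.hasDerivAt_integral_path x 0).tendsto_slope_zero_right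
  have h1 := (hP.hasDerivAt_integral_path x a).tendsto_slope_zero_right
  have h2 := (h1.sub h0).const_smul a⁻¹
  rw [max_eq_left ha.le, max_self, hP.zero_apply] at h2
  refine h2.congr' ?_
  filter_upwards [self_mem_nhdsWithin] with t ht
  have ht' : 0 ≤ t := (mem_Ioi.1 ht).le
  have hii : ∀ u v : ℝ, IntervalIntegrable (fun s => P (max s 0) x) volume u v := fun u v =>
    (hP.continuous_path x).intervalIntegrable u v
  have e1 : P t (∫ s in (0 : ℝ)..a, P (max s 0) x) = ∫ s in t..(a + t), P (max s 0) x := by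
    rw [← (P t).intervalIntegral_comp_comm (hii 0 a)]
    have := intervalIntegral.integral_comp_add_right (a := 0) (b := a)
      (fun s => P (max s 0) x) t
    rw [zero_add] at this
    rw [← this]
    refine intervalIntegral.integral_congr fun s hs => ?_
    rw [uIcc_of_le ha.le] at hs
    rw [max_eq_left hs.1, max_eq_left (add_nonneg hs.1 ht'), hP.apply_apply ht' hs.1, add_comm]
  simp only [orbitMean, map_smul, e1]
  rw [← smul_sub, ← smul_sub, smul_comm t⁻¹ a⁻¹]
  congr 2
  rw [zero_add, intervalIntegral.integral_same, sub_zero,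
    intervalIntegral.integral_interval_sub_left (hii _ _) (hii _ _),
    ← intervalIntegral.integral_interval_sub_left (hii 0 (a + t)) (hii 0 t),
    ← intervalIntegral.integral_interval_sub_left (hii 0 (a + t)) (hii 0 a)]
  abel

end IsMarkovSemigroup

variable {D : DirichletForm m}

lemma IsAssociated.orbitMean_mem (hD : IsAssociated D P) (hP : IsMarkovSemigroup P) {a : ℝ}
    (ha : 0 < a) (x : Lp ℝ 2 m) : orbitMean P a x ∈ D.dom :=
  ((hD _ _).1 (hP.tendsto_generator_orbitMean ha x)).1

/-- Association speaks only of generators; this identity is the bridge between the form and the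
approximating forms. -/
lemma IsAssociated.form_orbitMean (hD : IsAssociated D P) (hP : IsMarkovSemigroup P) {a : ℝ}
    (ha : 0 < a) (x : Lp ℝ 2 m) (v : D.dom) :
    D.form ⟨orbitMean P a x, hD.orbitMean_mem hP ha x⟩ v
      = a⁻¹ * inner ℝ (x - P a x) (v : Lp ℝ 2 m) := by
  rw [((hD _ _).1 (hP.tendsto_generator_orbitMean ha x)).2 v, ← inner_eq_integral,
    inner_smul_left, ← neg_sub x (P a x), inner_neg_left]
  simp

/-- Membership in the form domain from a bound on the approximating forms. -/
lemma IsAssociated.mem_dom (hD : IsAssociated D P) (hP : IsMarkovSemigroup P) {x : Lp ℝ 2 m}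
    {M : ℝ} (hM : ∀ t > 0, inner ℝ (x - P t x) x ≤ M * t) : x ∈ D.dom := by
  set a : ℕ → ℝ := fun n => 1 / ((n : ℝ) + 1) with ha
  have ha0 : ∀ n, 0 < a n := fun n => Nat.one_div_pos_of_nat
  set u : ℕ → D.dom := fun n => ⟨orbitMean P (a n) x, hD.orbitMean_mem hP (ha0 n) x⟩ with hu
  have hform : ∀ i j, D.form (u i) (u j)
      = (a i)⁻¹ * inner ℝ (x - P (a i) x) (orbitMean P (a j) x) := fun i j =>
    hD.form_orbitMean hP (ha0 i) x (u j)
  have hcross : ∀ i j, i ≤ j → D.form (u i) (u i) ≤ D.form (u i) (u j) := by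
    intro i j hij
    rw [hform, hform]
    have := inv_pos.2 (ha0 i)
    gcongr
    exact hP.inner_sub_orbitMean_anti (ha0 i).le (ha0 j) (Nat.one_div_le_one_div hij) x
  -- Since `𝓔(u_i, u_i) ≤ 𝓔(u_i, u_j)`, the energies increase and control the energy of differences.
  -- Bounded energies therefore make the orbit means a Cauchy sequence for the form norm.
  have hdiff : ∀ i j, i ≤ j →
      D.form (u i - u j) (u i - u j) ≤ D.form (u j) (u j) - D.form (u i) (u i) := by
    intro i j hij
    have h1 := hcross i j hij
    have h2 := D.symm (u j) (u i)
    simp only [map_sub, LinearMap.sub_apply]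
    linarith
  have hmono : Monotone fun n => D.form (u n) (u n) := by
    intro i j hij
    have := hdiff i j hij
    have := D.nonneg (u i - u j)
    simp only
    linarith
  have hbdd : ∀ n, D.form (u n) (u n) ≤ M := by
    intro n
    rw [hform, inv_mul_le_iff₀ (ha0 n), mul_comm]
    exact (hP.inner_sub_orbitMean_le (ha0 n).le (ha0 n) x).trans (hM _ (ha0 n))
  have hlim := tendsto_atTop_ciSup hmono ⟨M, by rintro _ ⟨n, rfl⟩; exact hbdd n⟩
  have hlimu : Tendsto (fun n => ((u n : D.dom) : Lp ℝ 2 m)) atTop (𝓝 x) := by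
    refine (hP.tendsto_orbitMean x).comp (tendsto_nhdsWithin_iff.2
      ⟨tendsto_one_div_add_atTop_nhds_zero_nat, Eventually.of_forall fun n => ha0 n⟩)
  obtain ⟨v, hv⟩ := D.complete u (by
    intro r hr
    obtain ⟨N₁, hN₁⟩ := Metric.cauchySeq_iff.1 hlim.cauchySeq (r / 2) (by positivity)
    obtain ⟨N₂, hN₂⟩ := Metric.cauchySeq_iff.1 hlimu.cauchySeq (√(r / 2))
      (Real.sqrt_pos.2 (by positivity))
    refine ⟨max N₁ N₂, fun i hi j hj => ?_⟩
    have h1 : D.form (u i - u j) (u i - u j) < r / 2 := by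
      wlog hij : i ≤ j generalizing i j
      · have := this j hj i hi (le_of_not_ge hij)
        rwa [← neg_sub (u i) (u j), map_neg, map_neg, LinearMap.neg_apply, neg_neg] at this
      have h3 := hN₁ j (le_of_max_le_left hj) i (le_of_max_le_left hi)
      rw [Real.dist_eq] at h3
      exact ((hdiff i j hij).trans (le_abs_self _)).trans_lt h3
    have h2 : ‖u i - u j‖ ^ 2 < r / 2 := by
      have h3 := hN₂ i (le_of_max_le_right hi) j (le_of_max_le_right hj)
      rw [dist_eq_norm] at h3
      exact (Real.lt_sqrt (norm_nonneg _)).1 h3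
    linarith)
  have hv2 : Tendsto (fun n => ‖u n - v‖ ^ 2) atTop (𝓝 0) :=
    squeeze_zero (fun n => sq_nonneg _)
      (fun n => le_add_of_nonneg_left (D.nonneg (u n - v))) hv
  have hv3 : Tendsto (fun n => ‖(u n : Lp ℝ 2 m) - v‖) atTop (𝓝 0) := by
    have h4 := (Real.continuous_sqrt.tendsto 0).comp hv2
    rw [Real.sqrt_zero] at h4
    refine h4.congr fun n => ?_
    simp only [Function.comp]
    rw [Real.sqrt_sq (norm_nonneg _)]
    rfl
  have hxv : x = v := tendsto_nhds_unique hlimu (tendsto_iff_norm_sub_tendsto_zero.2 hv3)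
  rw [hxv]
  exact v.2

/-- The approximating forms lie below the form. -/
lemma IsAssociated.inner_sub_le (hD : IsAssociated D P) (hP : IsMarkovSemigroup P) (u : D.dom)
    {t : ℝ} (ht : 0 < t) : inner ℝ ((u : Lp ℝ 2 m) - P t u) (u : Lp ℝ 2 m) ≤ D.form u u * t := by
  set w : D.dom := ⟨orbitMean P t u, hD.orbitMean_mem hP ht u⟩ with hw
  have h1 := hD.form_orbitMean hP ht u u
  have h2 := hD.form_orbitMean hP ht u w
  have h3 := mul_le_mul_of_nonneg_left (hP.inner_sub_orbitMean_le ht.le ht (u : Lp ℝ 2 m))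
    (inv_pos.2 ht).le
  -- With `A = t⁻¹ ⟨u - P_t u, u⟩` one has `𝓔(w, u) = A` and `𝓔(w, w) ≤ A`, so `0 ≤ 𝓔(u - w, u - w)
  -- ≤ 𝓔(u, u) - A`.
  have h4 := D.nonneg (u - w)
  have h5 := D.symm u w
  simp only [map_sub, LinearMap.sub_apply] at h4
  have h6 : t⁻¹ * inner ℝ ((u : Lp ℝ 2 m) - P t u) (u : Lp ℝ 2 m) ≤ D.form u u := by
    linarith
  rwa [inv_mul_le_iff₀ ht, mul_comm] at h6

end Semigroup

end OffDiag

namespace OffDiag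

/-! ### Normal contractions and stability of the form domain. -/

section Quadratic

variable {ι : Type*} [Fintype ι]

/-- Discrete Beurling–Deny splitting into a killing part and a jump part. With nonnegative weights,
contraction estimates can then be checked term by term. -/
lemma sum_sub_sum_eq (μ : ι → ℝ) (b : ι → ι → ℝ) (hsym : ∀ i j, b i j = b j i) (c : ι → ℝ) :
    ∑ i, μ i * c i ^ 2 - ∑ i, ∑ j, b i j * (c i * c j)
      = ∑ i, (μ i - ∑ j, b i j) * c i ^ 2 + 1 / 2 * ∑ i, ∑ j, b i j * (c i - c j) ^ 2 := by
  have h1 : ∑ i, ∑ j, b i j * c j ^ 2 = ∑ i, ∑ j, b i j * c i ^ 2 := by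
    rw [Finset.sum_comm]
    exact Finset.sum_congr rfl fun i _ => Finset.sum_congr rfl fun j _ => by rw [hsym]
  have h2 : ∑ i, ∑ j, b i j * (c i - c j) ^ 2 = ∑ i, ∑ j, b i j * c i ^ 2
      + ∑ i, ∑ j, b i j * c j ^ 2 - 2 * ∑ i, ∑ j, b i j * (c i * c j) := by
    simp only [Finset.mul_sum, ← Finset.sum_add_distrib, ← Finset.sum_sub_distrib]
    exact Finset.sum_congr rfl fun i _ => Finset.sum_congr rfl fun j _ => by ring
  have h3 : ∑ i, (μ i - ∑ j, b i j) * c i ^ 2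
      = ∑ i, μ i * c i ^ 2 - ∑ i, ∑ j, b i j * c i ^ 2 := by
    simp only [sub_mul, Finset.sum_mul, Finset.sum_sub_distrib]
  rw [h2, h3, h1]
  ring

lemma sum_sub_sum_le (μ : ι → ℝ) (b : ι → ι → ℝ) (hb : ∀ i j, 0 ≤ b i j)
    (hsym : ∀ i j, b i j = b j i) (hsum : ∀ i, ∑ j, b i j ≤ μ i) (c x y : ι → ℝ) (K : ℝ)
    (h1 : ∀ i, c i ^ 2 ≤ K * (x i ^ 2 + y i ^ 2))
    (h2 : ∀ i j, (c i - c j) ^ 2 ≤ K * ((x i - x j) ^ 2 + (y i - y j) ^ 2)) :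
    ∑ i, μ i * c i ^ 2 - ∑ i, ∑ j, b i j * (c i * c j)
      ≤ K * ((∑ i, μ i * x i ^ 2 - ∑ i, ∑ j, b i j * (x i * x j))
        + (∑ i, μ i * y i ^ 2 - ∑ i, ∑ j, b i j * (y i * y j))) := by
  rw [sum_sub_sum_eq μ b hsym, sum_sub_sum_eq μ b hsym, sum_sub_sum_eq μ b hsym]
  have e1 : ∑ i, (μ i - ∑ j, b i j) * c i ^ 2 ≤ K * (∑ i, (μ i - ∑ j, b i j) * x i ^ 2
      + ∑ i, (μ i - ∑ j, b i j) * y i ^ 2) := by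
    rw [← Finset.sum_add_distrib, Finset.mul_sum]
    refine Finset.sum_le_sum fun i _ => ?_
    calc _ ≤ (μ i - ∑ j, b i j) * (K * (x i ^ 2 + y i ^ 2)) :=
          mul_le_mul_of_nonneg_left (h1 i) (sub_nonneg.2 (hsum i))
      _ = _ := by ring
  have e2 : ∑ i, ∑ j, b i j * (c i - c j) ^ 2 ≤ K * (∑ i, ∑ j, b i j * (x i - x j) ^ 2
      + ∑ i, ∑ j, b i j * (y i - y j) ^ 2) := by
    simp only [← Finset.sum_add_distrib, Finset.mul_sum]
    refine Finset.sum_le_sum fun i _ => Finset.sum_le_sum fun j _ => ?_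
    calc _ ≤ b i j * (K * ((x i - x j) ^ 2 + (y i - y j) ^ 2)) :=
          mul_le_mul_of_nonneg_left (h2 i j) (hb i j)
      _ = _ := by ring
  linarith

end Quadratic

section Contraction

variable {E : Type*} [MeasurableSpace E] {m : Measure E} {P : ℝ → Lp ℝ 2 m →L[ℝ] Lp ℝ 2 m}

/-- The quadratic inequality for linear combinations of indicators of disjoint sets. -/
lemma IsMarkovSemigroup.inner_sub_sum_le (hP : IsMarkovSemigroup P) {t : ℝ} (ht : 0 ≤ t)
    {ι : Type*} [Fintype ι] {A : ι → Set E} (hA : ∀ i, MeasurableSet (A i))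
    (hμ : ∀ i, m (A i) ≠ ⊤) (hd : Pairwise (Function.onFun Disjoint A)) (c x y : ι → ℝ) (K : ℝ)
    (h1 : ∀ i, c i ^ 2 ≤ K * (x i ^ 2 + y i ^ 2))
    (h2 : ∀ i j, (c i - c j) ^ 2 ≤ K * ((x i - x j) ^ 2 + (y i - y j) ^ 2))
    {v v₁ v₂ : Lp ℝ 2 m} (hv : v = ∑ i, c i • indicatorConstLp 2 (hA i) (hμ i) (1 : ℝ))
    (hv₁ : v₁ = ∑ i, x i • indicatorConstLp 2 (hA i) (hμ i) (1 : ℝ))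
    (hv₂ : v₂ = ∑ i, y i • indicatorConstLp 2 (hA i) (hμ i) (1 : ℝ)) :
    inner ℝ (v - P t v) v
      ≤ K * (inner ℝ (v₁ - P t v₁) v₁ + inner ℝ (v₂ - P t v₂) v₂) := by
  classical
  set e : ι → Lp ℝ 2 m := fun i => indicatorConstLp 2 (hA i) (hμ i) (1 : ℝ) with he
  have hcoe : ∀ i, ∀ᵐ z ∂m, e i z = (A i).indicator (fun _ => (1 : ℝ)) z := fun i =>
    indicatorConstLp_coeFn
  have horth : ∀ i j, i ≠ j → inner ℝ (e i) (e j) = 0 := by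
    intro i j hij
    rw [inner_eq_integral]
    refine integral_eq_zero_of_ae ?_
    filter_upwards [hcoe i, hcoe j] with z hi hj
    rw [hi, hj]
    by_cases hz : z ∈ A i
    · have : z ∉ A j := fun hz' => (Set.disjoint_left.1 (hd hij)) hz hz'
      simp [this]
    · simp [hz]
  have hpos : ∀ i, ∀ᵐ z ∂m, 0 ≤ e i z ∧ e i z ≤ 1 := by
    intro i
    filter_upwards [hcoe i] with z hi
    rw [hi]
    by_cases hz : z ∈ A i <;> simp [hz]
  have hb : ∀ i j, 0 ≤ inner ℝ (P t (e i)) (e j) := by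
    intro i j
    rw [inner_eq_integral]
    refine integral_nonneg_of_ae ?_
    filter_upwards [hpos j, hP.markov t ht (e i) (hpos i)] with z hj hi
    exact mul_nonneg hi.1 hj.1
  -- The killing weights are nonnegative: disjointness gives `∑ e_j ≤ 1`, and `P_t` preserves the
  -- bound `≤ 1`.
  have hsum : ∀ i, ∑ j, inner ℝ (P t (e i)) (e j) ≤ inner ℝ (e i) (e i) := by
    intro i
    rw [← inner_sum, hP.inner_apply_left ht, inner_eq_integral, inner_eq_integral]
    have hone : ∀ᵐ z ∂m, 0 ≤ (∑ j, e j : Lp ℝ 2 m) z ∧ (∑ j, e j : Lp ℝ 2 m) z ≤ 1 := by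
      have hall : ∀ᵐ z ∂m, ∀ j, e j z = (A j).indicator (fun _ => (1 : ℝ)) z :=
        ae_all_iff.2 hcoe
      filter_upwards [hall, Lp.coeFn_finsetSum Finset.univ e] with z hz hsz
      rw [hsz, Finset.sum_apply]
      simp only [hz]
      by_cases hex : ∃ k, z ∈ A k
      · obtain ⟨k, hk⟩ := hex
        rw [Finset.sum_eq_single k]
        · simp [hk]
        · intro j _ hjk
          have : z ∉ A j := fun hz' => (Set.disjoint_left.1 (hd hjk)) hz' hk
          simp [this]
        · simp
      · push Not at hex
        simp [hex]
    refine integral_mono_ae ?_ ?_ ?_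
    · exact (Lp.memLp (e i)).integrable_mul (Lp.memLp _)
    · exact (Lp.memLp (e i)).integrable_mul (Lp.memLp _)
    · filter_upwards [hcoe i, hP.markov t ht _ hone] with z hi hz
      rw [hi]
      by_cases hz' : z ∈ A i
      · simpa [hz'] using hz.2
      · simp [hz']
  have hsym : ∀ i j, inner ℝ (P t (e i)) (e j) = inner ℝ (P t (e j)) (e i) := fun i j => by
    rw [hP.inner_apply_left ht, real_inner_comm]
  have hexp : ∀ c : ι → ℝ, inner ℝ ((∑ i, c i • e i) - P t (∑ i, c i • e i)) (∑ i, c i • e i)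
      = ∑ i, inner ℝ (e i) (e i) * c i ^ 2
        - ∑ i, ∑ j, inner ℝ (P t (e i)) (e j) * (c i * c j) := by
    intro c
    rw [inner_sub_left]
    congr 1
    · rw [sum_inner]
      refine Finset.sum_congr rfl fun i _ => ?_
      rw [inner_sum, Finset.sum_eq_single i]
      · simp only [real_inner_smul_left, real_inner_smul_right]
        ring
      · intro j _ hj
        simp only [real_inner_smul_left, real_inner_smul_right, horth i j hj.symm, mul_zero]
      · simp
    · rw [map_sum, sum_inner]
      refine Finset.sum_congr rfl fun i _ => ?_
      rw [inner_sum]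
      refine Finset.sum_congr rfl fun j _ => ?_
      simp only [map_smul, real_inner_smul_left, real_inner_smul_right]
      ring
  rw [hv, hv₁, hv₂, hexp c, hexp x, hexp y]
  exact sum_sub_sum_le _ _ hb hsym hsum c x y K h1 h2

/-- The approximating forms operate under Lipschitz functions of two variables. -/
lemma IsMarkovSemigroup.inner_sub_compLp_le (hP : IsMarkovSemigroup P) {t : ℝ} (ht : 0 ≤ t)
    {K : NNReal} {G : ℝ × ℝ → ℝ} (hG : LipschitzWith K G) (h0 : G 0 = 0)
    (U : Lp (ℝ × ℝ) 2 m) :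
    inner ℝ (hG.compLp h0 U - P t (hG.compLp h0 U)) (hG.compLp h0 U)
      ≤ (K : ℝ) ^ 2 *
        (inner ℝ ((LipschitzWith.prod_fst (α := ℝ) (β := ℝ)).compLp rfl U
            - P t ((LipschitzWith.prod_fst (α := ℝ) (β := ℝ)).compLp rfl U))
          ((LipschitzWith.prod_fst (α := ℝ) (β := ℝ)).compLp rfl U)
        + inner ℝ ((LipschitzWith.prod_snd (α := ℝ) (β := ℝ)).compLp rfl U
            - P t ((LipschitzWith.prod_snd (α := ℝ) (β := ℝ)).compLp rfl U))
          ((LipschitzWith.prod_snd (α := ℝ) (β := ℝ)).compLp rfl U)) := by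
  have hcont : ∀ {L : NNReal} {F : ℝ × ℝ → ℝ} (hF : LipschitzWith L F) (hF0 : F 0 = 0),
      Continuous fun U : Lp (ℝ × ℝ) 2 m =>
        (inner ℝ (hF.compLp hF0 U - P t (hF.compLp hF0 U)) (hF.compLp hF0 U) : ℝ) := by
    intro L F hF hF0
    have h1 : Continuous (hF.compLp hF0 : Lp (ℝ × ℝ) 2 m → Lp ℝ 2 m) := hF.continuous_compLp hF0
    exact (h1.sub ((P t).continuous.comp h1)).inner h1
  refine (Lp.simpleFunc.denseRange (E := ℝ × ℝ) (μ := m) (p := 2) (by norm_num)).induction_on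
    (p := fun U : Lp (ℝ × ℝ) 2 m =>
      (inner ℝ (hG.compLp h0 U - P t (hG.compLp h0 U)) (hG.compLp h0 U) : ℝ)
      ≤ (K : ℝ) ^ 2 *
        (inner ℝ ((LipschitzWith.prod_fst (α := ℝ) (β := ℝ)).compLp rfl U
            - P t ((LipschitzWith.prod_fst (α := ℝ) (β := ℝ)).compLp rfl U))
          ((LipschitzWith.prod_fst (α := ℝ) (β := ℝ)).compLp rfl U)
        + inner ℝ ((LipschitzWith.prod_snd (α := ℝ) (β := ℝ)).compLp rfl U
            - P t ((LipschitzWith.prod_snd (α := ℝ) (β := ℝ)).compLp rfl U))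
          ((LipschitzWith.prod_snd (α := ℝ) (β := ℝ)).compLp rfl U))) U ?_ ?_
  · exact isClosed_le (hcont _ _) (continuous_const.mul ((hcont _ _).add (hcont _ _)))
  intro f
  classical
  set s := Lp.simpleFunc.toSimpleFunc f with hs
  have hsf : s =ᵐ[m] (f : Lp (ℝ × ℝ) 2 m) := Lp.simpleFunc.toSimpleFunc_eq_toFun f
  have hmem : MemLp s 2 m := Lp.simpleFunc.memLp f
  -- The value zero is discarded because its level set may have infinite measure; `F 0 = 0` makes it
  -- irrelevant.
  set ι := {y // y ∈ s.range.filter (· ≠ 0)}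
  set A : ι → Set E := fun y => s ⁻¹' {y.1} with hAdef
  have hA : ∀ i, MeasurableSet (A i) := fun i => s.measurableSet_preimage _
  have hμ : ∀ i, m (A i) ≠ ⊤ := fun i =>
    (SimpleFunc.measure_preimage_lt_top_of_memLp (by norm_num) (by norm_num) s hmem i.1
      (Finset.mem_filter.1 i.2).2).ne
  have hd : Pairwise (Function.onFun Disjoint A) := by
    intro i j hij
    refine Set.disjoint_left.2 fun z hz hz' => hij (Subtype.ext ?_)
    exact (show s z = i.1 from hz).symm.trans hz'
  have hrep : ∀ {L : NNReal} {F : ℝ × ℝ → ℝ} (hF : LipschitzWith L F) (hF0 : F 0 = 0),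
      hF.compLp hF0 (f : Lp (ℝ × ℝ) 2 m)
        = ∑ i, F i.1 • indicatorConstLp 2 (hA i) (hμ i) (1 : ℝ) := by
    intro L F hF hF0
    refine Lp.ext ?_
    have hall : ∀ᵐ z ∂m, ∀ i : ι, (F i.1 • indicatorConstLp 2 (hA i) (hμ i) (1 : ℝ) : Lp ℝ 2 m) z
        = F i.1 * (A i).indicator (fun _ => (1 : ℝ)) z := by
      refine ae_all_iff.2 fun i => ?_
      filter_upwards [Lp.coeFn_smul (F i.1) (indicatorConstLp 2 (hA i) (hμ i) (1 : ℝ)),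
        indicatorConstLp_coeFn (p := 2) (hs := hA i) (hμs := hμ i) (c := (1 : ℝ))] with z h1 h2
      rw [h1, Pi.smul_apply, h2, smul_eq_mul]
    filter_upwards [hall, hF.coeFn_compLp hF0 (f : Lp (ℝ × ℝ) 2 m), hsf,
      Lp.coeFn_finsetSum Finset.univ
        fun i : ι => F i.1 • indicatorConstLp 2 (hA i) (hμ i) (1 : ℝ)] with z h1 h2 h3 h4
    rw [h4, Finset.sum_apply, h2]
    simp only [h1, Function.comp]
    rw [← h3]
    by_cases hz : s z = 0
    · rw [hz, hF0]
      refine (Finset.sum_eq_zero fun i _ => ?_).symm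
      have : z ∉ A i := fun hz' =>
        (Finset.mem_filter.1 i.2).2 ((show s z = i.1 from hz').symm.trans hz)
      simp [this]
    · have hzm : s z ∈ s.range.filter (· ≠ 0) :=
        Finset.mem_filter.2 ⟨SimpleFunc.mem_range_self s z, hz⟩
      rw [Finset.sum_eq_single (⟨s z, hzm⟩ : ι)]
      · have : z ∈ A ⟨s z, hzm⟩ := rfl
        simp [this]
      · intro i _ hi
        have : z ∉ A i := fun hz' => hi (Subtype.ext (show s z = i.1 from hz').symm)
        simp [this]
      · simp
  have hlip : ∀ p q : ℝ × ℝ,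
      (G p - G q) ^ 2 ≤ (K : ℝ) ^ 2 * ((p.1 - q.1) ^ 2 + (p.2 - q.2) ^ 2) := by
    intro p q
    have h1 := hG.dist_le_mul p q
    rw [Real.dist_eq] at h1
    have h2 : dist p q ^ 2 ≤ (p.1 - q.1) ^ 2 + (p.2 - q.2) ^ 2 := by
      rw [Prod.dist_eq, Real.dist_eq, Real.dist_eq]
      rcases max_choice |p.1 - q.1| |p.2 - q.2| with h | h <;> rw [h, sq_abs] <;>
        nlinarith [sq_nonneg (p.1 - q.1), sq_nonneg (p.2 - q.2)]
    calc (G p - G q) ^ 2 = |G p - G q| ^ 2 := (sq_abs _).symm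
      _ ≤ ((K : ℝ) * dist p q) ^ 2 := by gcongr
      _ = (K : ℝ) ^ 2 * dist p q ^ 2 := by ring
      _ ≤ _ := by gcongr
  refine hP.inner_sub_sum_le ht hA hμ hd (fun i => G i.1) (fun i => i.1.1) (fun i => i.1.2) _
    (fun i => ?_) (fun i j => hlip _ _) (hrep hG h0) (hrep LipschitzWith.prod_fst rfl)
    (hrep LipschitzWith.prod_snd rfl)
  have := hlip i.1 0
  simpa [h0] using this

/-- Smooth functions of two bounded elements of the form domain stay in the domain. -/
lemma IsAssociated.exists_comp {D : DirichletForm m} (hD : IsAssociated D P)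
    (hP : IsMarkovSemigroup P) {a b : Lp ℝ 2 m} (ha : a ∈ D.bddDom) (hb : b ∈ D.bddDom)
    {G : ℝ × ℝ → ℝ} (hG : ContDiff ℝ 1 G) (h0 : G 0 = 0) :
    ∃ w : D.dom, ∀ᵐ x ∂m, (w : Lp ℝ 2 m) x = G (a x, b x) := by
  obtain ⟨ha, M₁, hM₁⟩ := ha
  obtain ⟨hb, M₂, hM₂⟩ := hb
  set M := max 0 (max M₁ M₂) with hM
  have hM0 : 0 ≤ M := le_max_left _ _
  obtain ⟨K, hK⟩ := hG.contDiffOn.exists_lipschitzOnWith (s := Icc (-M) M ×ˢ Icc (-M) M)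
    one_ne_zero ((convex_Icc _ _).prod (convex_Icc _ _)) (isCompact_Icc.prod isCompact_Icc)
  -- Clamping to `[-M, M]` makes `G` globally Lipschitz without changing it on the values of `a` and
  -- `b`.
  set T : ℝ → ℝ := fun r => max (min M r) (-M) with hT
  have hTlip : LipschitzWith 1 T := (LipschitzWith.id.const_min M).max_const (-M)
  have hTmem : ∀ r, T r ∈ Icc (-M) M := fun r =>
    ⟨le_max_right _ _, max_le (min_le_left _ _) (by linarith)⟩
  have hTid : ∀ r, |r| ≤ M → T r = r := by
    intro r hr
    obtain ⟨h1, h2⟩ := abs_le.1 hr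
    simp only [hT]
    rw [min_eq_right h2, max_eq_left h1]
  set F : ℝ × ℝ → ℝ := fun p => G (T p.1, T p.2) with hF
  have hpair : LipschitzWith 1 fun p : ℝ × ℝ => (T p.1, T p.2) := by
    have := (hTlip.comp (LipschitzWith.prod_fst (α := ℝ) (β := ℝ))).prodMk
      (hTlip.comp (LipschitzWith.prod_snd (α := ℝ) (β := ℝ)))
    simpa using this
  have hFlip : LipschitzWith K F := by
    intro p q
    calc edist (F p) (F q) ≤ K * edist (T p.1, T p.2) (T q.1, T q.2) :=
          hK ⟨hTmem _, hTmem _⟩ ⟨hTmem _, hTmem _⟩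
      _ ≤ K * edist p q := by
          gcongr
          simpa using hpair p q
  have hT0 : T 0 = 0 := hTid 0 (by simpa using hM0)
  have hF0 : F 0 = 0 := by
    simp only [hF, Prod.fst_zero, Prod.snd_zero, hT0]
    exact h0
  have hUmem : MemLp (fun x => (a x, b x)) 2 m :=
    memLp_prod_iff.2 ⟨Lp.memLp a, Lp.memLp b⟩
  set U : Lp (ℝ × ℝ) 2 m := hUmem.toLp _ with hU
  have hUcoe : ∀ᵐ x ∂m, U x = (a x, b x) := hUmem.coeFn_toLp
  have hfst : (LipschitzWith.prod_fst (α := ℝ) (β := ℝ)).compLp rfl U = a := by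
    refine Lp.ext ?_
    filter_upwards [(LipschitzWith.prod_fst (α := ℝ) (β := ℝ)).coeFn_compLp rfl U, hUcoe]
      with x h1 h2
    rw [h1, Function.comp, h2]
  have hsnd : (LipschitzWith.prod_snd (α := ℝ) (β := ℝ)).compLp rfl U = b := by
    refine Lp.ext ?_
    filter_upwards [(LipschitzWith.prod_snd (α := ℝ) (β := ℝ)).coeFn_compLp rfl U, hUcoe]
      with x h1 h2
    rw [h1, Function.comp, h2]
  have hmem : hFlip.compLp hF0 U ∈ D.dom := by
    refine hD.mem_dom hP (M := (K : ℝ) ^ 2 * (D.form ⟨a, ha⟩ ⟨a, ha⟩ + D.form ⟨b, hb⟩ ⟨b, hb⟩))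
      fun t ht => ?_
    have h1 := hP.inner_sub_compLp_le ht.le hFlip hF0 U
    rw [hfst, hsnd] at h1
    have h2 := hD.inner_sub_le hP ⟨a, ha⟩ ht
    have h3 := hD.inner_sub_le hP ⟨b, hb⟩ ht
    refine h1.trans ?_
    rw [mul_assoc]
    gcongr
    linarith
  refine ⟨⟨_, hmem⟩, ?_⟩
  filter_upwards [hFlip.coeFn_compLp hF0 U, hUcoe, hM₁, hM₂] with x h1 h2 h3 h4
  rw [h1, Function.comp, h2]
  simp only [hF]
  rw [hTid _ (h3.trans ((le_max_left _ _).trans (le_max_right _ _))),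
    hTid _ (h4.trans ((le_max_right _ _).trans (le_max_right _ _)))]

end Contraction

end OffDiag

/-! ### Differentiation of power integrals. -/

namespace OffDiag

/-- The quadratic remainder is what an `L²` norm can absorb: along bounded curves, power integrals
are differentiable as soon as the curve is differentiable in `L²`. -/
lemma exists_pow_taylor_bound (n : ℕ) {M : ℝ} (hM : 0 ≤ M) : ∃ C, 0 ≤ C ∧ ∀ a b : ℝ,
    |a| ≤ M → |b| ≤ M →
      |a ^ (n + 1) - b ^ (n + 1) - (n + 1) * b ^ n * (a - b)| ≤ C * (a - b) ^ 2 := by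
  induction n with
  | zero => exact ⟨0, le_rfl, fun a b _ _ => by simp⟩
  | succ n ih =>
    obtain ⟨C, hC, h⟩ := ih
    refine ⟨M * C + (n + 1) * M ^ n, by positivity, fun a b ha hb => ?_⟩
    have e : a ^ (n + 1 + 1) - b ^ (n + 1 + 1) - (((n + 1 : ℕ) : ℝ) + 1) * b ^ (n + 1) * (a - b)
        = a * (a ^ (n + 1) - b ^ (n + 1) - (n + 1) * b ^ n * (a - b))
          + (n + 1) * b ^ n * (a - b) ^ 2 := by
      push_cast
      ring
    rw [e]
    calc _ ≤ |a * (a ^ (n + 1) - b ^ (n + 1) - (n + 1) * b ^ n * (a - b))|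
          + |(n + 1) * b ^ n * (a - b) ^ 2| := abs_add_le _ _
      _ = |a| * |a ^ (n + 1) - b ^ (n + 1) - (n + 1) * b ^ n * (a - b)|
          + (n + 1) * |b| ^ n * (a - b) ^ 2 := by
        rw [abs_mul, abs_mul, abs_mul, abs_pow, abs_of_nonneg (sq_nonneg (a - b)),
          abs_of_nonneg (by positivity : (0 : ℝ) ≤ n + 1)]
      _ ≤ M * (C * (a - b) ^ 2) + (n + 1) * M ^ n * (a - b) ^ 2 := by
        gcongr
        exact h a b ha hb
      _ = _ := by ring

section Powers

variable {E : Type*} [MeasurableSpace E] {m : Measure E}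

lemma memLp_mul_pow {ω : E → ℝ} {A M : ℝ} (hω : AEStronglyMeasurable ω m)
    (hA : ∀ᵐ x ∂m, |ω x| ≤ A) {f : Lp ℝ 2 m} (hf : ∀ᵐ x ∂m, |f x| ≤ M) (n : ℕ) :
    MemLp (fun x => ω x * f x ^ (n + 1)) 2 m := by
  refine (Lp.memLp f).of_le_mul (c := A * M ^ n)
    (hω.mul ((Lp.aestronglyMeasurable f).pow _)) ?_
  filter_upwards [hA, hf] with x h1 h2
  rw [Real.norm_eq_abs, Real.norm_eq_abs, abs_mul, abs_pow, pow_succ, ← mul_assoc]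
  have : 0 ≤ A := (abs_nonneg _).trans h1
  gcongr

lemma integrable_mul_pow {ω : E → ℝ} {A M : ℝ} (hω : AEStronglyMeasurable ω m)
    (hA : ∀ᵐ x ∂m, |ω x| ≤ A) {f : Lp ℝ 2 m} (hf : ∀ᵐ x ∂m, |f x| ≤ M) (n : ℕ) :
    Integrable (fun x => ω x * f x ^ (n + 2)) m := by
  have h := (memLp_mul_pow hω hA hf n).integrable_mul (Lp.memLp f)
  refine h.congr (ae_of_all _ fun x => ?_)
  simp only [Pi.mul_apply]
  ring

lemma norm_sq_eq_integral (f : Lp ℝ 2 m) : ‖f‖ ^ 2 = ∫ x, f x ^ 2 ∂m := by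
  rw [← real_inner_self_eq_norm_sq, inner_eq_integral]
  simp only [sq]

/-- Differentiation of weighted power integrals along a bounded `L²`-differentiable curve. -/
lemma hasDerivWithinAt_integral_mul_pow {ω : E → ℝ} {A M : ℝ} (hω : AEStronglyMeasurable ω m)
    (hA : ∀ᵐ x ∂m, |ω x| ≤ A) (hM0 : 0 ≤ M) {h : ℝ → Lp ℝ 2 m}
    (hM : ∀ r, ∀ᵐ x ∂m, |h r x| ≤ M) {k : Lp ℝ 2 m} {s : Set ℝ} {t : ℝ}
    (hd : HasDerivWithinAt h k s t) (n : ℕ) :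
    HasDerivWithinAt (fun r => ∫ x, ω x * h r x ^ (n + 2) ∂m)
      ((n + 2) * ∫ x, ω x * h t x ^ (n + 1) * k x ∂m) s t := by
  obtain ⟨C, hC, hTay⟩ := exists_pow_taylor_bound (n + 1) hM0
  have hq := memLp_mul_pow hω hA (hM t) n
  set q : Lp ℝ 2 m := hq.toLp _ with hqdef
  have hqcoe : ∀ᵐ x ∂m, q x = ω x * h t x ^ (n + 1) := hq.coeFn_toLp
  set U : ℝ → ℝ := fun r => ∫ x, ω x * h r x ^ (n + 2) ∂m with hU
  -- The derivative is carried by the `L²` pairing with `q = ω h_t^(n+1)`; the remainder `R` is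
  -- `O(‖h r - h t‖²)`, hence `o(r - t)`.
  set R : ℝ → ℝ := fun r => U r - U t - (n + 2) * inner ℝ q (h r - h t) with hR
  have hintU : ∀ r, Integrable (fun x => ω x * h r x ^ (n + 2)) m := fun r =>
    integrable_mul_pow hω hA (hM r) n
  have hinner : ∀ y : Lp ℝ 2 m, inner ℝ q y = ∫ x, ω x * h t x ^ (n + 1) * y x ∂m := by
    intro y
    rw [inner_eq_integral]
    refine integral_congr_ae ?_
    filter_upwards [hqcoe] with x hx
    rw [hx]
  have hbound : ∀ r, ‖R r‖ ≤ A * C * ‖h r - h t‖ ^ 2 := by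
    intro r
    have hinti : Integrable (fun x => ω x * h t x ^ (n + 1) * (h r - h t : Lp ℝ 2 m) x) m :=
      hq.integrable_mul (Lp.memLp (h r - h t))
    have hRe : R r = ∫ x, (ω x * h r x ^ (n + 2) - ω x * h t x ^ (n + 2)
        - (n + 2) * (ω x * h t x ^ (n + 1) * (h r - h t : Lp ℝ 2 m) x)) ∂m := by
      have e1 := integral_sub ((hintU r).sub (hintU t)) (hinti.const_mul ((n : ℝ) + 2))
      have e2 := integral_sub (hintU r) (hintU t)
      simp only [Pi.sub_apply] at e1
      rw [e1, e2, integral_const_mul, ← hinner]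
    rw [hRe, norm_sq_eq_integral, ← integral_const_mul]
    refine norm_integral_le_of_norm_le ((Lp.memLp (h r - h t)).integrable_sq.const_mul _) ?_
    filter_upwards [hA, hM r, hM t, Lp.coeFn_sub (h r) (h t)] with x h1 h2 h3 h4
    rw [h4, Pi.sub_apply]
    have h5 := hTay _ _ h2 h3
    have e : ω x * h r x ^ (n + 2) - ω x * h t x ^ (n + 2)
        - (n + 2) * (ω x * h t x ^ (n + 1) * (h r x - h t x))
        = ω x * (h r x ^ (n + 1 + 1) - h t x ^ (n + 1 + 1)
          - (((n + 1 : ℕ) : ℝ) + 1) * h t x ^ (n + 1) * (h r x - h t x)) := by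
      push_cast
      ring
    rw [e, Real.norm_eq_abs, abs_mul, mul_assoc A]
    exact mul_le_mul h1 h5 (abs_nonneg _) ((abs_nonneg _).trans h1)
  have hRd : HasDerivWithinAt R 0 s t := by
    rw [hasDerivWithinAt_iff_isLittleO]
    have hRt : R t = 0 := by simp [hR]
    have h1 : (fun r => h r - h t) =O[𝓝[s] t] fun r => r - t :=
      (HasDerivAtFilter.isBigO_sub hd).comp_tendsto (tendsto_id.prodMk tendsto_const_pure)
    have h2 : (fun r => ‖h r - h t‖ ^ 2) =O[𝓝[s] t] fun r => (r - t) ^ 2 := h1.norm_left.pow 2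
    have h3 : (fun r => (r - t) ^ 2) =o[𝓝[s] t] fun r => r - t := by
      have h4 : (fun r => r - t) =o[𝓝[s] t] fun _ => (1 : ℝ) := by
        rw [Asymptotics.isLittleO_one_iff]
        have : Continuous fun r : ℝ => r - t := by fun_prop
        have := (this.tendsto t).mono_left (nhdsWithin_le_nhds (s := s))
        simpa using this
      simpa [sq] using h4.mul_isBigO (Asymptotics.isBigO_refl (fun r => r - t) (𝓝[s] t))
    have h5 : R =O[𝓝[s] t] fun r => ‖h r - h t‖ ^ 2 :=
      Asymptotics.IsBigO.of_bound (A * C) (Eventually.of_forall fun r => by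
        simpa using hbound r)
    simpa [hRt] using (h5.trans h2).trans_isLittleO h3
  have hlin : HasDerivWithinAt (fun r => inner ℝ q (h r - h t)) (inner ℝ q k) s t :=
    (innerSL ℝ q).hasFDerivAt.comp_hasDerivWithinAt t (hd.sub_const (h t))
  have hsum := (hRd.add (hlin.const_mul ((n : ℝ) + 2))).add_const (U t)
  rw [zero_add, hinner] at hsum
  have hfun : U = fun r => R r + ((n : ℝ) + 2) * inner ℝ q (h r - h t) + U t := by
    funext r
    simp only [hR]
    ring
  rw [hfun]
  exact hsum

end Powers

end OffDiag

/-! ### Generator, Davies bound and Nash inequality along the orbit. -/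

namespace OffDiag

variable {E : Type*} [MeasurableSpace E] {m : Measure E} {P : ℝ → Lp ℝ 2 m →L[ℝ] Lp ℝ 2 m}
  {D : DirichletForm m}

lemma IsMarkovSemigroup.apply_mem_Icc (hP : IsMarkovSemigroup P) {t : ℝ} (ht : 0 ≤ t) {M : ℝ}
    (hM : 0 < M) {f : Lp ℝ 2 m} (hf : ∀ᵐ x ∂m, 0 ≤ f x ∧ f x ≤ M) :
    ∀ᵐ x ∂m, 0 ≤ P t f x ∧ P t f x ≤ M := by
  have h1 : ∀ᵐ x ∂m, 0 ≤ (M⁻¹ • f) x ∧ (M⁻¹ • f) x ≤ 1 := by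
    filter_upwards [hf, Lp.coeFn_smul M⁻¹ f] with x h1 h2
    rw [h2, Pi.smul_apply, smul_eq_mul]
    exact ⟨mul_nonneg (inv_pos.2 hM).le h1.1, by rw [inv_mul_le_iff₀ hM]; linarith [h1.2]⟩
  filter_upwards [hP.markov t ht _ h1, Lp.coeFn_smul M⁻¹ (P t f)] with x h2 h3
  rw [map_smul, h3, Pi.smul_apply, smul_eq_mul] at h2
  refine ⟨?_, ?_⟩
  · exact (mul_nonneg_iff_of_pos_left (inv_pos.2 hM)).1 h2.1
  · have := h2.2
    rw [inv_mul_le_iff₀ hM] at this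
    linarith

/-- The semigroup is differentiable on the domain of its generator. -/
lemma IsMarkovSemigroup.hasDerivWithinAt_path (hP : IsMarkovSemigroup P) {g k : Lp ℝ 2 m}
    (hg : Tendsto (fun t : ℝ => t⁻¹ • (P t g - g)) (𝓝[>] 0) (𝓝 k)) {t : ℝ} (ht : 0 ≤ t) :
    HasDerivWithinAt (fun r => P (max r 0) g) (P t k) (Ici 0) t := by
  set J : ℝ → Lp ℝ 2 m := fun r => ∫ s in (0 : ℝ)..r, P (max s 0) k with hJ
  have hright : ∀ x, 0 ≤ x → HasDerivWithinAt (fun r => P (max r 0) g) (P x k) (Ici x) x := by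
    intro x hx
    have h1 : Tendsto (fun s : ℝ => s⁻¹ • (P (max (x + s) 0) g - P (max x 0) g)) (𝓝[>] 0)
        (𝓝 (P x k)) := by
      refine (((P x).continuous.tendsto k).comp hg).congr' ?_
      filter_upwards [self_mem_nhdsWithin] with s hs
      have hs' : 0 ≤ s := (mem_Ioi.1 hs).le
      simp only [Function.comp]
      rw [map_smul, map_sub, hP.apply_apply hx hs', max_eq_left hx,
        max_eq_left (add_nonneg hx hs')]
    rw [← hasDerivWithinAt_Ioi_iff_Ici, hasDerivWithinAt_iff_tendsto_slope' (by simp)]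
    have h2 : Tendsto (fun y : ℝ => y - x) (𝓝[>] x) (𝓝[>] 0) := by
      refine tendsto_nhdsWithin_iff.2 ⟨?_, ?_⟩
      · have : Continuous fun y : ℝ => y - x := by fun_prop
        simpa using (this.tendsto x).mono_left nhdsWithin_le_nhds
      · filter_upwards [self_mem_nhdsWithin] with y hy
        exact sub_pos.2 (mem_Ioi.1 hy)
    refine (h1.comp h2).congr fun y => ?_
    simp [slope, vsub_eq_sub]
  -- The generator yields right derivatives only. Subtracting the primitive `J` leaves a continuous
  -- function with zero right derivative, so the orbit equals `g + J` and inherits its full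
  -- derivative.
  have hconst : ∀ x, 0 ≤ x → P (max x 0) g = g + J x := by
    intro x hx
    have hc : ContinuousOn (fun r => P (max r 0) g - J r) (Icc 0 x) := by
      refine ((hP.continuous_path g).sub ?_).continuousOn
      exact continuous_iff_continuousAt.2 fun b => (hP.hasDerivAt_integral_path k b).continuousAt
    have hz := constant_of_has_deriv_right_zero hc (fun y hy => by
      have h1 := (hright y hy.1).sub (hP.hasDerivAt_integral_path k y).hasDerivWithinAt
      rw [max_eq_left hy.1, sub_self] at h1
      exact h1) x (right_mem_Icc.2 hx)
    simp only [hJ, intervalIntegral.integral_same, max_self, hP.zero_apply, sub_zero] at hz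
    exact sub_eq_iff_eq_add.1 hz
  have h1 := ((hP.hasDerivAt_integral_path k t).const_add g).hasDerivWithinAt (s := Ici 0)
  rw [max_eq_left ht] at h1
  exact h1.congr (fun x hx => hconst x hx) (hconst t ht)

/-- The generator commutes with the semigroup. -/
lemma IsMarkovSemigroup.tendsto_generator_apply (hP : IsMarkovSemigroup P) {g k : Lp ℝ 2 m}
    (hg : Tendsto (fun t : ℝ => t⁻¹ • (P t g - g)) (𝓝[>] 0) (𝓝 k)) {r : ℝ} (hr : 0 ≤ r) :
    Tendsto (fun t : ℝ => t⁻¹ • (P t (P r g) - P r g)) (𝓝[>] 0) (𝓝 (P r k)) := by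
  refine (((P r).continuous.tendsto k).comp hg).congr' ?_
  filter_upwards [self_mem_nhdsWithin] with s hs
  have hs' : 0 ≤ s := (mem_Ioi.1 hs).le
  simp only [Function.comp]
  rw [map_smul, map_sub, hP.comm hr hs']

/-- The pointwise power bound behind the differential inequalities. -/
lemma IsAssociated.exists_pow_form_le (hD : IsAssociated D P) (hP : IsMarkovSemigroup P)
    {C₀ : ℝ} {K : ℝ → ℝ} {ψ : Lp ℝ 2 m} (hψ : ψ ∈ D.bddDom) (hDB : D.DaviesBound C₀ K ψ)
    {h k : Lp ℝ 2 m} {M : ℝ} (hh : ∀ᵐ x ∂m, 0 ≤ h x ∧ h x ≤ M) (hk : D.IsGenerator h k) (q : ℕ) :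
    ∃ w : D.dom, (∀ᵐ x ∂m, (w : Lp ℝ 2 m) x = (Real.exp (ψ x) * h x) ^ (q + 1)) ∧
      (2 * (q + 1 : ℝ)) * ∫ x, Real.exp (ψ x) ^ (2 * (q + 1)) * h x ^ (2 * q + 1) * k x ∂m
        ≤ -2 * C₀ * D.form w w
          + 2 * (q + 1) * K (q + 1) * ∫ x, (Real.exp (ψ x) * h x) ^ (2 * (q + 1)) ∂m := by
  obtain ⟨hdom, hgen⟩ := hk
  have hhb : h ∈ D.bddDom := ⟨hdom, M, by
    filter_upwards [hh] with x hx
    rw [abs_of_nonneg hx.1]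
    exact hx.2⟩
  -- The Davies bound is used with `p = q + 1` and `f = e^ψ h`, so that `e^(-ψ) f = h` and `2p - 1 =
  -- 2q + 1`.
  obtain ⟨f, hf⟩ := hD.exists_comp hP hhb hψ (G := fun p => Real.exp p.2 * p.1)
    (by fun_prop) (by simp)
  obtain ⟨u, hu⟩ := hD.exists_comp hP hhb hψ
    (G := fun p => Real.exp p.2 * (Real.exp p.2 * p.1) ^ (2 * q + 1)) (by fun_prop) (by simp)
  obtain ⟨w, hw⟩ := hD.exists_comp hP hhb hψ
    (G := fun p => (Real.exp p.2 * p.1) ^ (q + 1)) (by fun_prop) (by simp)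
  refine ⟨w, hw, ?_⟩
  have hf0 : ∀ᵐ x ∂m, 0 ≤ (f : Lp ℝ 2 m) x := by
    filter_upwards [hf, hh] with x h1 h2
    rw [h1]
    exact mul_nonneg (Real.exp_pos _).le h2.1
  obtain ⟨B, hB⟩ := hψ.2
  have hfb : (f : Lp ℝ 2 m) ∈ D.bddDom := ⟨f.2, Real.exp B * M, by
    filter_upwards [hf, hh, hB] with x h1 h2 h3
    rw [h1, abs_of_nonneg (mul_nonneg (Real.exp_pos _).le h2.1)]
    have h4 : Real.exp (ψ x) ≤ Real.exp B := Real.exp_le_exp.2 (le_of_abs_le h3)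
    exact mul_le_mul h4 h2.2 h2.1 (Real.exp_pos _).le⟩
  have hp1 : (1 : ℝ) ≤ (q : ℝ) + 1 := by
    have : (0 : ℝ) ≤ q := Nat.cast_nonneg q
    linarith
  have key := hDB ((q : ℝ) + 1) hp1 f hfb hf0 u ⟨h, hdom⟩ w
    (by
      filter_upwards [hf, hu] with x h1 h2
      rw [h2, h1, show (2 : ℝ) * (q + 1) - 1 = ((2 * q + 1 : ℕ) : ℝ) by push_cast; ring,
        Real.rpow_natCast])
    (by
      filter_upwards [hf] with x h1
      rw [h1, ← mul_assoc, ← Real.exp_add]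
      simp)
    (by
      filter_upwards [hf, hw] with x h1 h2
      rw [h2, h1, show (q : ℝ) + 1 = ((q + 1 : ℕ) : ℝ) by push_cast; ring, Real.rpow_natCast])
  have e1 : ∫ x, (f : Lp ℝ 2 m) x ^ (2 * ((q : ℝ) + 1)) ∂m
      = ∫ x, (Real.exp (ψ x) * h x) ^ (2 * (q + 1)) ∂m := by
    refine integral_congr_ae ?_
    filter_upwards [hf] with x h1
    rw [h1, show (2 : ℝ) * ((q : ℝ) + 1) = ((2 * (q + 1) : ℕ) : ℝ) by push_cast; ring,
      Real.rpow_natCast]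
  have e2 : ∫ x, Real.exp (ψ x) ^ (2 * (q + 1)) * h x ^ (2 * q + 1) * k x ∂m
      = - D.form u ⟨h, hdom⟩ := by
    rw [D.symm, hgen u, neg_neg]
    refine integral_congr_ae ?_
    filter_upwards [hu] with x h1
    rw [h1]
    ring
  rw [e1] at key
  rw [e2]
  have hq0 : (0 : ℝ) < q + 1 := by linarith
  have h3 := mul_le_mul_of_nonneg_left key (by positivity : (0 : ℝ) ≤ 2 * ((q : ℝ) + 1))
  have h4 : 2 * ((q : ℝ) + 1) * (C₀ / (q + 1) * D.form w w) = 2 * C₀ * D.form w w := by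
    field_simp
  rw [mul_sub, h4] at h3
  linarith

/-- The Nash inequality for a function whose `L¹` norm is at most `N`. -/
lemma DirichletForm.Nash.scaled {θ : ℝ → ℝ} {δ : ℝ} (hN : D.Nash θ δ) {w : D.dom} (hw : w ≠ 0)
    (hint : Integrable (w : Lp ℝ 2 m) m) {N : ℝ} (hN0 : 0 < N)
    (hle : ∫ x, |(w : Lp ℝ 2 m) x| ∂m ≤ N) :
    θ (‖w‖ ^ 2 / N ^ 2) * N ^ 2 ≤ D.form w w + δ * ‖w‖ ^ 2 := by
  have hcoe : ∀ᵐ x ∂m, ((N⁻¹ • w : D.dom) : Lp ℝ 2 m) x = N⁻¹ * (w : Lp ℝ 2 m) x := by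
    filter_upwards [Lp.coeFn_smul N⁻¹ (w : Lp ℝ 2 m)] with x hx
    rw [Submodule.coe_smul, hx, Pi.smul_apply, smul_eq_mul]
  have h1 := hN (N⁻¹ • w) (smul_ne_zero (inv_ne_zero hN0.ne') hw)
    ((hint.const_mul N⁻¹).congr (hcoe.mono fun x hx => hx.symm)) (by
      have : ∫ x, |((N⁻¹ • w : D.dom) : Lp ℝ 2 m) x| ∂m
          = N⁻¹ * ∫ x, |(w : Lp ℝ 2 m) x| ∂m := by
        rw [← integral_const_mul]
        refine integral_congr_ae ?_
        filter_upwards [hcoe] with x hx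
        rw [hx, abs_mul, abs_of_pos (inv_pos.2 hN0)]
      rw [this, inv_mul_le_iff₀ hN0]
      linarith)
  rw [norm_smul, norm_inv, Real.norm_of_nonneg hN0.le, map_smul, map_smul, LinearMap.smul_apply,
    smul_eq_mul, smul_eq_mul] at h1
  have e : (N⁻¹ * ‖w‖) ^ 2 = ‖w‖ ^ 2 / N ^ 2 := by
    field_simp
  rw [e] at h1
  have h2 := mul_le_mul_of_nonneg_right h1 (sq_nonneg N)
  calc _ ≤ _ := h2
    _ = _ := by field_simp

lemma le_exp_mul_of_deriv_le {f f' : ℝ → ℝ} {a b c : ℝ} (hab : a ≤ b)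
    (hf : ContinuousOn f (Icc a b)) (hd : ∀ r ∈ Ioo a b, HasDerivAt f (f' r) r)
    (hle : ∀ r ∈ Ioo a b, f' r ≤ c * f r) : f b ≤ Real.exp (c * (b - a)) * f a := by
  have hanti : AntitoneOn (fun r => Real.exp (-(c * r)) * f r) (Icc a b) := by
    have hd' : ∀ r ∈ Ioo a b, HasDerivAt (fun r => Real.exp (-(c * r)) * f r)
        (Real.exp (-(c * r)) * (-c) * f r + Real.exp (-(c * r)) * f' r) r := by
      intro r hr
      have h1 : HasDerivAt (fun r => -(c * r)) (-c) r := by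
        simpa using ((hasDerivAt_id' r).const_mul c).fun_neg
      exact h1.exp.mul (hd r hr)
    refine antitoneOn_of_deriv_nonpos (convex_Icc a b) ?_ ?_ ?_
    · exact (by fun_prop : Continuous fun r => Real.exp (-(c * r))).continuousOn.mul hf
    · rw [interior_Icc]
      exact fun r hr => (hd' r hr).differentiableAt.differentiableWithinAt
    · rw [interior_Icc]
      intro r hr
      rw [(hd' r hr).deriv]
      have h2 := mul_le_mul_of_nonneg_left (hle r hr) (Real.exp_pos (-(c * r))).le
      linarith
  have h1 := hanti (left_mem_Icc.2 hab) (right_mem_Icc.2 hab) hab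
  simp only at h1
  calc f b = Real.exp (c * b) * (Real.exp (-(c * b)) * f b) := by
        rw [← mul_assoc, ← Real.exp_add]
        simp
    _ ≤ Real.exp (c * b) * (Real.exp (-(c * a)) * f a) := by gcongr
    _ = _ := by
        rw [← mul_assoc, ← Real.exp_add]
        ring_nf

end OffDiag

/-! ### Perturbed orbits and the Nash smoothing step. -/

namespace OffDiag

variable {E : Type*} [MeasurableSpace E] {m : Measure E} {P : ℝ → Lp ℝ 2 m →L[ℝ] Lp ℝ 2 m}
  {D : DirichletForm m} {C₀ : ℝ} {K : ℝ → ℝ} {ψ g : Lp ℝ 2 m}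

/-- The integral of the `N`-th power of the perturbed orbit of `g` at time `r`. -/
def orbitPow (P : ℝ → Lp ℝ 2 m →L[ℝ] Lp ℝ 2 m) (ψ g : Lp ℝ 2 m) (N : ℕ) (r : ℝ) : ℝ :=
  ∫ x, (Real.exp (ψ x) * P (max r 0) g x) ^ N ∂m

/-- A nonnegative bounded initial datum in the domain of the generator, and a bounded weight
satisfying the Davies bound. -/
structure DaviesOrbit (D : DirichletForm m) (P : ℝ → Lp ℝ 2 m →L[ℝ] Lp ℝ 2 m) (C₀ : ℝ)
    (K : ℝ → ℝ) (ψ g : Lp ℝ 2 m) : Prop where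
  markov : IsMarkovSemigroup P
  assoc : IsAssociated D P
  mem : ψ ∈ D.bddDom
  davies : D.DaviesBound C₀ K ψ
  nonneg : 0 ≤ C₀
  gen : ∃ k, Tendsto (fun t : ℝ => t⁻¹ • (P t g - g)) (𝓝[>] 0) (𝓝 k)
  bdd : ∃ M > 0, ∀ᵐ x ∂m, 0 ≤ g x ∧ g x ≤ M

lemma aestronglyMeasurable_exp_pow (ψ : Lp ℝ 2 m) (N : ℕ) :
    AEStronglyMeasurable (fun x => Real.exp (ψ x) ^ N) m :=
  (Real.continuous_exp.comp_aestronglyMeasurable (Lp.aestronglyMeasurable ψ)).pow N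

lemma exists_exp_pow_le (hψ : ψ ∈ D.bddDom) (N : ℕ) :
    ∃ A, ∀ᵐ x ∂m, |Real.exp (ψ x) ^ N| ≤ A := by
  obtain ⟨B, hB⟩ := hψ.2
  refine ⟨Real.exp B ^ N, ?_⟩
  filter_upwards [hB] with x hx
  rw [abs_of_nonneg (by positivity)]
  have := Real.exp_le_exp.2 (le_of_abs_le hx)
  gcongr

namespace DaviesOrbit

lemma exists_bound (h : DaviesOrbit D P C₀ K ψ g) :
    ∃ M > 0, ∀ r, ∀ᵐ x ∂m, 0 ≤ P (max r 0) g x ∧ P (max r 0) g x ≤ M := by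
  obtain ⟨M, hM, hg⟩ := h.bdd
  exact ⟨M, hM, fun r => h.markov.apply_mem_Icc (le_max_right _ _) hM hg⟩

lemma orbit_nonneg (h : DaviesOrbit D P C₀ K ψ g) (r : ℝ) :
    ∀ᵐ x ∂m, 0 ≤ Real.exp (ψ x) * P (max r 0) g x := by
  obtain ⟨M, -, hM⟩ := h.exists_bound
  filter_upwards [hM r] with x hx
  exact mul_nonneg (Real.exp_pos _).le hx.1

lemma integrable (h : DaviesOrbit D P C₀ K ψ g) (N : ℕ) (r : ℝ) :
    Integrable (fun x => (Real.exp (ψ x) * P (max r 0) g x) ^ (N + 2)) m := by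
  obtain ⟨M, -, hM⟩ := h.exists_bound
  obtain ⟨A, hA⟩ := exists_exp_pow_le h.mem (N + 2)
  have h1 := integrable_mul_pow (aestronglyMeasurable_exp_pow ψ (N + 2)) hA
    (f := P (max r 0) g) (M := M) (by
      filter_upwards [hM r] with x hx
      rw [abs_of_nonneg hx.1]
      exact hx.2) N
  simpa only [mul_pow] using h1

lemma orbitPow_nonneg (h : DaviesOrbit D P C₀ K ψ g) (N : ℕ) (r : ℝ) :
    0 ≤ orbitPow P ψ g N r := by
  refine integral_nonneg_of_ae ?_
  filter_upwards [h.orbit_nonneg r] with x hx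
  exact pow_nonneg hx N

/-- The energy inequality along the orbit. The power `w` is exposed because the Nash inequality will
be applied to it. -/
lemma exists_deriv (h : DaviesOrbit D P C₀ K ψ g) (q : ℕ) {r : ℝ} (hr : 0 ≤ r) :
    ∃ V' : ℝ, HasDerivWithinAt (orbitPow P ψ g (2 * (q + 1))) V' (Ici 0) r ∧
      ∃ w : D.dom,
        (∀ᵐ x ∂m, (w : Lp ℝ 2 m) x = (Real.exp (ψ x) * P (max r 0) g x) ^ (q + 1)) ∧
        V' ≤ -2 * C₀ * D.form w w
          + 2 * (q + 1) * K (q + 1) * orbitPow P ψ g (2 * (q + 1)) r := by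
  obtain ⟨M, hM0, hM⟩ := h.exists_bound
  obtain ⟨k, hk⟩ := h.gen
  obtain ⟨A, hA⟩ := exists_exp_pow_le h.mem (2 * (q + 1))
  have hgen : D.IsGenerator (P (max r 0) g) (P r k) := by
    rw [max_eq_left hr]
    exact (h.assoc _ _).1 (h.markov.tendsto_generator_apply hk hr)
  obtain ⟨w, hw, hle⟩ := h.assoc.exists_pow_form_le h.markov h.mem h.davies (hM r) hgen q
  have hd := hasDerivWithinAt_integral_mul_pow (aestronglyMeasurable_exp_pow ψ (2 * (q + 1))) hA
    hM0.le (h := fun r => P (max r 0) g) (fun r => by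
      filter_upwards [hM r] with x hx
      rw [abs_of_nonneg hx.1]
      exact hx.2) (h.markov.hasDerivWithinAt_path hk hr) (2 * q)
  refine ⟨_, ?_, w, hw, hle⟩
  have e : orbitPow P ψ g (2 * (q + 1))
      = fun r => ∫ x, Real.exp (ψ x) ^ (2 * (q + 1)) * P (max r 0) g x ^ (2 * q + 2) ∂m := by
    funext r
    simp only [orbitPow, mul_pow]
    rfl
  rw [e]
  convert hd using 1
  push_cast
  ring

lemma continuousOn (h : DaviesOrbit D P C₀ K ψ g) (q : ℕ) :
    ContinuousOn (orbitPow P ψ g (2 * (q + 1))) (Ici 0) := by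
  intro r hr
  obtain ⟨V', hV', -⟩ := h.exists_deriv q hr
  exact hV'.continuousWithinAt

/-- The nonnegative energy is dropped and Gronwall's inequality applied. -/
lemma growth (h : DaviesOrbit D P C₀ K ψ g) (q : ℕ) {a b : ℝ} (ha : 0 ≤ a) (hab : a ≤ b) :
    orbitPow P ψ g (2 * (q + 1)) b
      ≤ Real.exp (2 * (q + 1) * K (q + 1) * (b - a)) * orbitPow P ψ g (2 * (q + 1)) a := by
  have hex : ∀ r : ℝ, ∃ V' : ℝ, 0 ≤ r →
      HasDerivWithinAt (orbitPow P ψ g (2 * (q + 1))) V' (Ici 0) r ∧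
      V' ≤ 2 * (q + 1) * K (q + 1) * orbitPow P ψ g (2 * (q + 1)) r := by
    intro r
    by_cases hr : 0 ≤ r
    · obtain ⟨V', h1, w, -, h2⟩ := h.exists_deriv q hr
      refine ⟨V', fun _ => ⟨h1, h2.trans ?_⟩⟩
      have := mul_nonneg h.nonneg (D.nonneg w)
      linarith
    · exact ⟨0, fun hr' => absurd hr' hr⟩
  choose V' hV' using hex
  refine le_exp_mul_of_deriv_le hab
    ((h.continuousOn q).mono fun x hx => ha.trans hx.1) (f' := V') (fun r hr => ?_)
    fun r hr => ?_
  · have hr0 : 0 < r := ha.trans_lt hr.1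
    exact (hV' r hr0.le).1.hasDerivAt (Ici_mem_nhds hr0)
  · exact (hV' r (ha.trans hr.1.le)).2

lemma orbitPow_eq_zero (h : DaviesOrbit D P C₀ K ψ g) {N N' : ℕ} {r : ℝ}
    (h0 : orbitPow P ψ g (N + 2) r = 0) : orbitPow P ψ g (N' + 1) r = 0 := by
  have h1 := (integral_eq_zero_iff_of_nonneg_ae (by
    filter_upwards [h.orbit_nonneg r] with x hx
    exact pow_nonneg hx _) (h.integrable N r)).1 h0
  refine integral_eq_zero_of_ae ?_
  filter_upwards [h1] with x hx
  have hx0 : Real.exp (ψ x) * P (max r 0) g x = 0 := pow_eq_zero_iff (by omega) |>.1 hx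
  rw [hx0]
  simp

variable {θ : ℝ → ℝ} {δ c₁ c₂ l₀ : ℝ} {cl Cl : ℝ → ℝ}

/-- The smoothing step from exponent `q` to exponent `2q`. -/
lemma nash_step (h : DaviesOrbit D P C₀ K ψ g) (hθ : ThetaConditions θ c₁ c₂ l₀ cl Cl)
    (hc₁ : 1 ≤ c₁) (hc₂ : 1 ≤ c₂) (hN : D.Nash θ δ) (hC₀ : 0 < C₀) (hδ : 0 ≤ δ) (p : ℕ)
    (hK : K (p + 1) ≤ K (2 * (p + 1))) {a s : ℝ} (ha : 0 ≤ a) (hs : 0 < s) :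
    orbitPow P ψ g (4 * (p + 1)) (a + s)
      ≤ Real.exp ((4 * (p + 1) * K (2 * (p + 1)) + 2 * C₀ * δ) * s)
        * orbitPow P ψ g (2 * (p + 1)) a ^ 2 * profile θ (2 * C₀ * s) := by
  have hprof := (hθ.profile_spec hc₁ hc₂ (y := 2 * C₀ * s) (by positivity)).1
  have hrhs : 0 ≤ Real.exp ((4 * (p + 1) * K (2 * (p + 1)) + 2 * C₀ * δ) * s)
        * orbitPow P ψ g (2 * (p + 1)) a ^ 2 * profile θ (2 * C₀ * s) := by positivity
  -- The power `w = u^(q+1)` then has `‖w‖₂² = ∫ u^(4(p+1))` and `‖w‖₁ = ∫ u^(2(p+1))`, the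
  -- quantities at the new and at the old exponent.
  set q : ℕ := 2 * p + 1 with hq
  have e4 : 4 * (p + 1) = 2 * (q + 1) := by omega
  have eq1 : q + 1 = 2 * (p + 1) := by omega
  have eqr : (q : ℝ) + 1 = 2 * (p + 1) := by rw [hq]; push_cast; ring
  rw [e4]
  set V : ℝ → ℝ := orbitPow P ψ g (2 * (q + 1)) with hV
  set N₀ := orbitPow P ψ g (2 * (p + 1)) a with hN₀
  by_cases hz : V (a + s) = 0
  · rw [hz]
    exact hrhs
  have hVs : 0 < V (a + s) := lt_of_le_of_ne (h.orbitPow_nonneg _ _) (Ne.symm hz)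
  -- By the growth bound a zero of `V` would persist up to time `a + s`.
  have hVpos : ∀ r ∈ Icc 0 s, 0 < V (a + r) := by
    intro r hr
    have h1 := h.growth q (a := a + r) (b := a + s) (by linarith [hr.1]) (by linarith [hr.2])
    by_contra! hcon
    have h2 : Real.exp (2 * (q + 1) * K (q + 1) * (a + s - (a + r))) * V (a + r) ≤ 0 :=
      mul_nonpos_of_nonneg_of_nonpos (Real.exp_pos _).le hcon
    linarith
  have hN₀pos : 0 < N₀ := by
    refine lt_of_le_of_ne (h.orbitPow_nonneg _ _) fun hcon => ?_
    have h1 : orbitPow P ψ g (2 * p + 2) a = 0 := hcon.symm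
    have h2 : V a = 0 := h.orbitPow_eq_zero (N' := 2 * q + 1) h1
    have h3 := hVpos 0 ⟨le_rfl, hs.le⟩
    rw [add_zero, h2] at h3
    exact lt_irrefl _ h3
  -- One constant serves twice: it collects the linear terms in `V'` (the rate and the defect `2 C₀
  -- δ` from Nash), and `e^(κr/2) N₀` dominates the `L¹` norm of `w`, since `K (p+1) ≤ K (2(p+1))`.
  set κ : ℝ := 4 * (p + 1) * K (2 * (p + 1)) + 2 * C₀ * δ with hκ
  have hex : ∀ r : ℝ, ∃ V' : ℝ, r ∈ Ioo 0 s → HasDerivAt V V' (a + r) ∧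
      V' ≤ -(2 * C₀ * (θ (V (a + r) / (Real.exp (κ * r) * N₀ ^ 2))
        * (Real.exp (κ * r) * N₀ ^ 2))) + κ * V (a + r) := by
    intro r
    by_cases hr : r ∈ Ioo 0 s
    swap
    · exact ⟨0, fun hr' => absurd hr' hr⟩
    have har : 0 < a + r := by linarith [hr.1]
    obtain ⟨V', hd, w, hw, hle⟩ := h.exists_deriv q har.le
    refine ⟨V', fun _ => ⟨hd.hasDerivAt (Ici_mem_nhds har), hle.trans ?_⟩⟩
    have hnorm : ‖w‖ ^ 2 = V (a + r) := by
      rw [show ‖w‖ = ‖(w : Lp ℝ 2 m)‖ from rfl, norm_sq_eq_integral]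
      refine integral_congr_ae ?_
      filter_upwards [hw] with x hx
      rw [hx, ← pow_mul, mul_comm (q + 1) 2]
    have hw0 : w ≠ 0 := by
      rintro rfl
      have := hVpos r (Ioo_subset_Icc_self hr)
      rw [← hnorm] at this
      simp at this
    have hwint : Integrable (w : Lp ℝ 2 m) m :=
      (h.integrable (2 * p) (a + r)).congr (by
        filter_upwards [hw] with x hx
        rw [hx, eq1])
    have hwN : ∫ x, |(w : Lp ℝ 2 m) x| ∂m ≤ Real.exp (κ / 2 * r) * N₀ := by
      have h1 : ∫ x, |(w : Lp ℝ 2 m) x| ∂m = orbitPow P ψ g (2 * (p + 1)) (a + r) := by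
        refine integral_congr_ae ?_
        filter_upwards [hw, h.orbit_nonneg (a + r)] with x hx hx0
        rw [hx, abs_of_nonneg (pow_nonneg hx0 _), eq1]
      rw [h1]
      refine (h.growth p ha (by linarith [hr.1] : a ≤ a + r)).trans ?_
      refine mul_le_mul_of_nonneg_right (Real.exp_le_exp.2 ?_) hN₀pos.le
      rw [add_sub_cancel_left]
      refine mul_le_mul_of_nonneg_right ?_ hr.1.le
      have h2 : 2 * ((p : ℝ) + 1) * K (p + 1) ≤ 2 * (p + 1) * K (2 * (p + 1)) := by gcongr
      have h3 : 0 ≤ C₀ * δ := by positivity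
      rw [hκ]
      linarith
    have hnash := hN.scaled hw0 hwint (by positivity : 0 < Real.exp (κ / 2 * r) * N₀) hwN
    have e1 : (Real.exp (κ / 2 * r) * N₀) ^ 2 = Real.exp (κ * r) * N₀ ^ 2 := by
      rw [mul_pow, ← Real.exp_nat_mul]
      congr 2
      push_cast
      ring
    rw [e1, hnorm] at hnash
    have h4 := mul_le_mul_of_nonneg_left hnash (by positivity : 0 ≤ 2 * C₀)
    rw [eqr, hκ]
    have h5 : orbitPow P ψ g (2 * (q + 1)) (a + r) = V (a + r) := rfl
    rw [h5]
    linarith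
  choose V' hV' using hex
  -- Dividing by the squared `L¹` bound `e^(κr) N₀²` cancels the linear term and leaves `W' ≤ -2 C₀
  -- θ(W)`.
  set W : ℝ → ℝ := fun r => Real.exp (-(κ * r)) * V (a + r) / N₀ ^ 2 with hW
  have hWe : ∀ r, V (a + r) / (Real.exp (κ * r) * N₀ ^ 2) = W r := by
    intro r
    simp only [hW]
    rw [Real.exp_neg]
    field_simp
  have key : W s ≤ profile θ (2 * C₀ * s) := by
    refine hθ.le_profile hc₁ hc₂ (W := W)
      (W' := fun r => (Real.exp (-(κ * r)) * (-κ) * V (a + r)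
        + Real.exp (-(κ * r)) * V' r) / N₀ ^ 2)
      (by positivity) hs ?_ ?_ ?_ ?_
    · refine ContinuousOn.div_const (ContinuousOn.mul ?_ ?_) _
      · exact (by fun_prop : Continuous fun r => Real.exp (-(κ * r))).continuousOn
      · exact (h.continuousOn q).comp (by fun_prop) fun r hr => by
          have := hr.1
          exact mem_Ici.2 (by linarith)
    · intro r hr
      have := hVpos r hr
      simp only [hW]
      positivity
    · intro r hr
      have h1 : HasDerivAt (fun r => -(κ * r)) (-κ) r := by
        simpa using ((hasDerivAt_id' r).const_mul κ).fun_neg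
      have h2 : HasDerivAt (fun r => V (a + r)) (V' r) r := by
        simpa using (hV' r hr).1.comp_const_add a r
      exact (h1.exp.mul h2).div_const _
    · intro r hr
      have h1 := (hV' r hr).2
      rw [hWe] at h1
      rw [div_le_iff₀ (by positivity)]
      have h2 := mul_le_mul_of_nonneg_left h1 (Real.exp_pos (-(κ * r))).le
      have h3 : Real.exp (-(κ * r)) * Real.exp (κ * r) = 1 := by
        rw [← Real.exp_add]
        simp
      have h4 : Real.exp (-(κ * r)) * (-(2 * C₀ * (θ (W r) * (Real.exp (κ * r) * N₀ ^ 2)))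
          + κ * V (a + r)) = (Real.exp (-(κ * r)) * Real.exp (κ * r)) *
            (-(2 * C₀ * θ (W r)) * N₀ ^ 2) + Real.exp (-(κ * r)) * κ * V (a + r) := by ring
      rw [h4, h3] at h2
      linarith
  rw [← hWe] at key
  rw [div_le_iff₀ (by positivity)] at key
  calc V (a + s) ≤ _ := key
    _ = _ := by ring

end DaviesOrbit

/-- A nonnegative function whose `L^p` norms along the dyadic exponents are controlled by a
convergent sequence is bounded by its limit. -/
lemma ae_le_of_integral_pow_le {f : E → ℝ} (hf : ∀ᵐ x ∂m, 0 ≤ f x) {b : ℕ → ℝ} {B : ℝ}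
    (hb0 : ∀ k, 0 ≤ b k) (hb : Tendsto b atTop (𝓝 B))
    (hint : ∀ k : ℕ, Integrable (fun x => f x ^ 2 ^ (k + 1)) m)
    (hle : ∀ k : ℕ, ∫ x, f x ^ 2 ^ (k + 1) ∂m ≤ b k ^ 2 ^ (k + 1)) :
    ∀ᵐ x ∂m, f x ≤ B := by
  have hB : 0 ≤ B := ge_of_tendsto' hb hb0
  have main : ∀ c > B, ∀ᵐ x ∂m, f x < c := by
    intro c hc
    have hc0 : 0 < c := hB.trans_lt hc
    obtain ⟨c', hc'1, hc'2⟩ := exists_between hc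
    have hc'0 : 0 ≤ c' := hB.trans hc'1.le
    set μ := m {x | c ≤ f x} with hμ
    -- Chebyshev's inequality for the power `2^(k+1)`: since `c' < c`, the bound tends to zero.
    have hmark : ∀ᶠ k : ℕ in atTop, μ ≤ ENNReal.ofReal ((c' / c) ^ 2 ^ (k + 1)) := by
      filter_upwards [hb.eventually (gt_mem_nhds hc'1)] with k hk
      have hpos : 0 < c ^ 2 ^ (k + 1) := by positivity
      have h1 := mul_meas_ge_le_integral_of_nonneg (μ := m) (f := fun x => f x ^ 2 ^ (k + 1))
        (by filter_upwards [hf] with x hx; exact pow_nonneg hx _) (hint k) (c ^ 2 ^ (k + 1))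
      have hfin : m {x | c ^ 2 ^ (k + 1) ≤ f x ^ 2 ^ (k + 1)} ≠ ⊤ :=
        ((hint k).measure_ge_lt_top hpos).ne
      have h2 : m.real {x | c ^ 2 ^ (k + 1) ≤ f x ^ 2 ^ (k + 1)} ≤ (c' / c) ^ 2 ^ (k + 1) := by
        rw [div_pow, le_div_iff₀ hpos, mul_comm]
        refine h1.trans ((hle k).trans ?_)
        have := hb0 k
        gcongr
      calc μ ≤ m {x | c ^ 2 ^ (k + 1) ≤ f x ^ 2 ^ (k + 1)} :=
            measure_mono fun x hx => pow_le_pow_left₀ hc0.le hx _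
        _ = ENNReal.ofReal (m.real {x | c ^ 2 ^ (k + 1) ≤ f x ^ 2 ^ (k + 1)}) :=
            (ENNReal.ofReal_toReal hfin).symm
        _ ≤ _ := ENNReal.ofReal_le_ofReal h2
    have hlim : Tendsto (fun k : ℕ => ENNReal.ofReal ((c' / c) ^ 2 ^ (k + 1))) atTop (𝓝 0) := by
      rw [← ENNReal.ofReal_zero]
      refine ENNReal.tendsto_ofReal ?_
      refine (tendsto_pow_atTop_nhds_zero_of_lt_one (by positivity)
        ((div_lt_one hc0).2 hc'2)).comp ?_
      exact (tendsto_pow_atTop_atTop_of_one_lt one_lt_two).comp (tendsto_add_atTop_nat 1)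
    have hzero : μ = 0 := le_antisymm (ge_of_tendsto hlim hmark) bot_le
    rw [ae_iff]
    simpa only [not_lt] using hzero
  have hall : ∀ᵐ x ∂m, ∀ n : ℕ, f x < B + 1 / ((n : ℝ) + 1) :=
    ae_all_iff.2 fun n => main _ (by
      have : (0 : ℝ) < 1 / ((n : ℝ) + 1) := Nat.one_div_pos_of_nat
      linarith)
  filter_upwards [hall] with x hx
  have h1 : Tendsto (fun n : ℕ => B + 1 / ((n : ℝ) + 1)) atTop (𝓝 (B + 0)) :=
    tendsto_const_nhds.add tendsto_one_div_add_atTop_nhds_zero_nat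
  rw [add_zero] at h1
  exact ge_of_tendsto' h1 fun n => (hx n).le

end OffDiag

/-! ### Dyadic iteration up to `L^∞`. -/

namespace OffDiag

section Rates

/-- The total growth rate accumulated along the dyadic time steps. -/
lemma sum_rate_le {K : ℝ → ℝ} {C η ε l δ T : ℝ} (hK0 : ∀ r, 1 ≤ r → 0 ≤ K r)
    (hKm : MonotoneOn K (Ici 1)) (hKd : ∀ R, 1 ≤ R → K R ≤ C * R ^ η * K 1)
    (hl : 2 ≤ l) (hq : ∀ n : ℕ, ∑ j ∈ Finset.Icc 1 n, C * ((2 : ℝ) ^ η / l) ^ j ≤ ε)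
    (hδ : 0 ≤ δ) (hT : 0 ≤ T) (k : ℕ) :
    K (2 ^ k) * (T * (l ^ (k + 1))⁻¹) + (K 1 * ((l - 1) * (l ^ (0 + 1))⁻¹ * T)
      + ∑ j ∈ Finset.Icc 1 k, (K (2 ^ j) + δ) * ((l - 1) * (l ^ (j + 1))⁻¹ * T))
      ≤ ((1 + ε) * K 1 + δ) * T := by
  have hl0 : 0 < l := by linarith
  have hK1 := hK0 1 le_rfl
  have hpow1 : ∀ j : ℕ, (1 : ℝ) ≤ 2 ^ j := fun j => one_le_pow₀ one_le_two
  have hKj : ∀ j : ℕ, K (2 ^ j) ≤ C * ((2 : ℝ) ^ η) ^ j * K 1 := by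
    intro j
    have := hKd _ (hpow1 j)
    rwa [← Real.rpow_natCast, ← Real.rpow_mul zero_le_two, mul_comm (j : ℝ) η,
      Real.rpow_mul zero_le_two, Real.rpow_natCast, Real.rpow_natCast] at this
  have hfrac : ∀ j : ℕ, (l - 1) * (l ^ (j + 1))⁻¹ ≤ (l ^ j)⁻¹ := by
    intro j
    rw [pow_succ, mul_inv]
    have h1 : 0 < (l ^ j)⁻¹ := by positivity
    have h2 : (l - 1) * l⁻¹ ≤ 1 := by
      rw [← div_eq_mul_inv, div_le_one hl0]
      linarith
    nlinarith
  have hterm : ∀ j : ℕ, K (2 ^ j) * (T * (l ^ j)⁻¹) ≤ C * ((2 : ℝ) ^ η / l) ^ j * (K 1 * T) := by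
    intro j
    calc K (2 ^ j) * (T * (l ^ j)⁻¹) ≤ C * ((2 : ℝ) ^ η) ^ j * K 1 * (T * (l ^ j)⁻¹) := by
          gcongr
          exact hKj j
      _ = _ := by
          rw [div_pow, div_eq_mul_inv]
          ring
  have h0 : (l - 1) * (l ^ (0 + 1))⁻¹ * T ≤ T := by
    have := hfrac 0
    simp only [pow_zero, inv_one] at this
    exact mul_le_of_le_one_left hT this
  -- The leftover stretch of length `T l^(-(k+1))` is charged, by monotonicity of `K`, as term `k +
  -- 1` of the geometric series.
  have hlast : K (2 ^ k) * (T * (l ^ (k + 1))⁻¹)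
      ≤ C * ((2 : ℝ) ^ η / l) ^ (k + 1) * (K 1 * T) := by
    refine le_trans ?_ (hterm (k + 1))
    gcongr
    exact hKm (hpow1 k) (hpow1 (k + 1)) (pow_le_pow_right₀ one_le_two (by omega))
  have hsplit : ∑ j ∈ Finset.Icc 1 k, (K (2 ^ j) + δ) * ((l - 1) * (l ^ (j + 1))⁻¹ * T)
      = ∑ j ∈ Finset.Icc 1 k, K (2 ^ j) * ((l - 1) * (l ^ (j + 1))⁻¹ * T)
        + δ * ∑ j ∈ Finset.Icc 1 k, ((l - 1) * (l ^ (j + 1))⁻¹ * T) := by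
    rw [Finset.mul_sum, ← Finset.sum_add_distrib]
    exact Finset.sum_congr rfl fun j _ => by ring
  have hsum1 : ∑ j ∈ Finset.Icc 1 k, K (2 ^ j) * ((l - 1) * (l ^ (j + 1))⁻¹ * T)
      ≤ ∑ j ∈ Finset.Icc 1 k, C * ((2 : ℝ) ^ η / l) ^ j * (K 1 * T) := by
    refine Finset.sum_le_sum fun j _ => le_trans ?_ (hterm j)
    have := hK0 _ (hpow1 j)
    have := hfrac j
    rw [mul_comm T]
    gcongr
  have htele : ∀ k : ℕ, ∑ j ∈ Finset.Icc 1 k, ((l - 1) * (l ^ (j + 1))⁻¹ * T)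
      = T * l⁻¹ - T * (l ^ (k + 1))⁻¹ := by
    intro k
    induction k with
    | zero => simp
    | succ k ih =>
      rw [Finset.sum_Icc_succ_top (by omega), ih]
      field_simp
      ring
  have hsum2 : ∑ j ∈ Finset.Icc 1 k, ((l - 1) * (l ^ (j + 1))⁻¹ * T) ≤ T := by
    rw [htele]
    have h1 : 0 ≤ T * (l ^ (k + 1))⁻¹ := by positivity
    have h2 : T * l⁻¹ ≤ T := mul_le_of_le_one_right hT (inv_le_one_of_one_le₀ (by linarith))
    linarith
  have hgeo := hq (k + 1)
  rw [Finset.sum_Icc_succ_top (by omega)] at hgeo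
  have h5 := mul_le_mul_of_nonneg_right hgeo (mul_nonneg hK1 hT)
  rw [add_mul, Finset.sum_mul] at h5
  have h6 := mul_le_mul_of_nonneg_left hsum2 hδ
  have h7 := mul_le_mul_of_nonneg_left h0 hK1
  rw [hsplit]
  linarith

end Rates

variable {E : Type*} [MeasurableSpace E] {m : Measure E} {P : ℝ → Lp ℝ 2 m →L[ℝ] Lp ℝ 2 m}
  {D : DirichletForm m} {C₀ : ℝ} {K : ℝ → ℝ} {ψ g : Lp ℝ 2 m}
  {θ : ℝ → ℝ} {δ c₁ c₂ l₀ : ℝ} {cl Cl : ℝ → ℝ}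

namespace DaviesOrbit

lemma growth_dyadic (h : DaviesOrbit D P C₀ K ψ g) (k : ℕ) {a b : ℝ} (ha : 0 ≤ a)
    (hab : a ≤ b) :
    orbitPow P ψ g (2 ^ (k + 1)) b
      ≤ Real.exp (K (2 ^ k) * (b - a)) ^ 2 ^ (k + 1) * orbitPow P ψ g (2 ^ (k + 1)) a := by
  obtain ⟨q, hq⟩ : ∃ q, 2 ^ k = q + 1 := ⟨2 ^ k - 1, by have := Nat.one_le_two_pow (n := k); omega⟩
  have hq' : (2 : ℝ) ^ k = q + 1 := by exact_mod_cast hq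
  have e : 2 ^ (k + 1) = 2 * (q + 1) := by rw [pow_succ, hq, mul_comm]
  have h1 := h.growth q ha hab
  rw [← e] at h1
  refine h1.trans_eq ?_
  rw [← Real.exp_nat_mul, hq', e]
  push_cast
  ring_nf

lemma nash_step_dyadic (h : DaviesOrbit D P C₀ K ψ g) (hθ : ThetaConditions θ c₁ c₂ l₀ cl Cl)
    (hc₁ : 1 ≤ c₁) (hc₂ : 1 ≤ c₂) (hN : D.Nash θ δ) (hC₀ : 0 < C₀) (hC₀1 : C₀ ≤ 1)
    (hδ : 0 ≤ δ) (hKm : MonotoneOn K (Ici 1)) (k : ℕ) {a s : ℝ} (ha : 0 ≤ a) (hs : 0 < s) :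
    orbitPow P ψ g (2 ^ (k + 2)) (a + s)
      ≤ Real.exp ((K (2 ^ (k + 1)) + δ) * s) ^ 2 ^ (k + 2)
        * orbitPow P ψ g (2 ^ (k + 1)) a ^ 2 * profile θ (2 * C₀ * s) := by
  obtain ⟨q, hq⟩ : ∃ q, 2 ^ k = q + 1 := ⟨2 ^ k - 1, by have := Nat.one_le_two_pow (n := k); omega⟩
  have hq' : (2 : ℝ) ^ k = q + 1 := by exact_mod_cast hq
  have e : 2 ^ (k + 1) = 2 * (q + 1) := by rw [pow_succ, hq, mul_comm]
  have e2 : 2 ^ (k + 2) = 4 * (q + 1) := by rw [pow_add, hq]; ring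
  have e' : (2 : ℝ) ^ (k + 1) = 2 * (q + 1) := by exact_mod_cast e
  have hq1 : (1 : ℝ) ≤ q + 1 := by
    have : (0 : ℝ) ≤ q := Nat.cast_nonneg q
    linarith
  have h1 := h.nash_step hθ hc₁ hc₂ hN hC₀ hδ q
    (hKm (mem_Ici.2 hq1) (mem_Ici.2 (by linarith)) (by linarith)) ha hs
  rw [← e2, ← e] at h1
  refine h1.trans ?_
  have hprof := (hθ.profile_spec hc₁ hc₂ (y := 2 * C₀ * s) (by positivity)).1
  rw [← Real.exp_nat_mul, e', e2]
  refine mul_le_mul_of_nonneg_right (mul_le_mul_of_nonneg_right (Real.exp_le_exp.2 ?_)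
    (sq_nonneg _)) hprof.le
  rw [← mul_assoc]
  refine mul_le_mul_of_nonneg_right ?_ hs.le
  push_cast
  -- Here `C₀ ≤ 1` enters: the defect `2 C₀ δ` is at most `2^(k+2) δ`, so it costs no more than `δ`
  -- per unit time after taking the `2^(k+2)`-th root.
  have h2 : C₀ * δ ≤ 1 * δ := mul_le_mul_of_nonneg_right hC₀1 hδ
  have h3 : 1 * δ ≤ (q + 1) * δ := mul_le_mul_of_nonneg_right hq1 hδ
  nlinarith

/-- The `L² → L^∞` bound for the perturbed semigroup on good initial data. -/
lemma ae_le (h : DaviesOrbit D P C₀ K ψ g) (hθ : ThetaConditions θ c₁ c₂ l₀ cl Cl)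
    (hc₁ : 1 ≤ c₁) (hc₂ : 1 ≤ c₂) (hN : D.Nash θ δ) (hC₀ : 0 < C₀) (hC₀1 : C₀ ≤ 1)
    (hδ : 0 ≤ δ) (hK0 : ∀ r, 1 ≤ r → 0 ≤ K r) (hKm : MonotoneOn K (Ici 1)) {C η ε l : ℝ}
    (hKd : ∀ R, 1 ≤ R → K R ≤ C * R ^ η * K 1) (hl : 2 ≤ l)
    (hq : ∀ n : ℕ, ∑ j ∈ Finset.Icc 1 n, C * ((2 : ℝ) ^ η / l) ^ j ≤ ε) {T L : ℝ} (hT : 0 < T)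
    (hL : Tendsto (fun n : ℕ => ∏ k ∈ Finset.Icc 1 n,
      profile θ ((l - 1) * (l ^ (k + 1))⁻¹ * (2 * C₀ * T)) ^ ((1 : ℝ) / 2 ^ k)) atTop (𝓝 L)) :
    ∀ᵐ x ∂m, Real.exp (ψ x) * P T g x
      ≤ Real.exp (((1 + ε) * K 1 + δ) * T) * √L * √(orbitPow P ψ g 2 0) := by
  have hl0 : 0 < l := by linarith
  have hl1 : 0 < l - 1 := by linarith
  set s : ℕ → ℝ := fun j => (l - 1) * (l ^ (j + 1))⁻¹ * T with hs
  have hspos : ∀ j, 0 < s j := fun j => by simp only [hs]; positivity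
  -- The partial sums `s_0 + … + s_k`, increasing to `T`.
  set τ : ℕ → ℝ := fun k => T - T * (l ^ (k + 1))⁻¹ with hτ
  have hτ0 : ∀ k, 0 ≤ τ k := by
    intro k
    have : (l ^ (k + 1))⁻¹ ≤ 1 := inv_le_one_of_one_le₀ (one_le_pow₀ (by linarith))
    have := mul_le_of_le_one_right hT.le this
    simp only [hτ]
    linarith
  have hτs : ∀ k, τ (k + 1) = τ k + s (k + 1) := by
    intro k
    simp only [hτ, hs]
    field_simp
    ring
  set Q : ℕ → ℝ := fun n => ∏ k ∈ Finset.Icc 1 n,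
      profile θ ((l - 1) * (l ^ (k + 1))⁻¹ * (2 * C₀ * T)) ^ ((1 : ℝ) / 2 ^ k) with hQ
  have hprof : ∀ k, 0 < profile θ ((l - 1) * (l ^ (k + 1))⁻¹ * (2 * C₀ * T)) := fun k =>
    (hθ.profile_spec hc₁ hc₂ (by positivity)).1
  have hQ0 : ∀ n, 0 ≤ Q n := fun n => Finset.prod_nonneg fun k _ =>
    Real.rpow_nonneg (hprof k).le _
  set X : ℕ → ℝ := fun k => K 1 * s 0 + ∑ j ∈ Finset.Icc 1 k, (K (2 ^ j) + δ) * s j with hX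
  set F : ℝ := √(orbitPow P ψ g 2 0) with hF
  have hF2 : F ^ 2 = orbitPow P ψ g 2 0 := Real.sq_sqrt (h.orbitPow_nonneg 2 0)
  have hF0 : 0 ≤ F := Real.sqrt_nonneg _
  -- Step `0` uses growth in `L²` only, which is why the product starts at `k = 1`. Afterwards the
  -- `2^(k+2)`-th root of the profile factor is the square root of its `2^(k+1)`-th root, whence
  -- `√(Q k)`.
  have claim : ∀ k : ℕ, orbitPow P ψ g (2 ^ (k + 1)) (τ k)
      ≤ (Real.exp (X k) * √(Q k) * F) ^ 2 ^ (k + 1) := by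
    intro k
    induction k with
    | zero =>
      have h1 := h.growth_dyadic 0 le_rfl (hτ0 0)
      have e0 : τ 0 = s 0 := by
        simp only [hτ, hs]
        field_simp
        ring
      simp only [zero_add, pow_one, pow_zero, sub_zero] at h1 ⊢
      refine h1.trans_eq ?_
      rw [← hF2, e0]
      simp [hX, hQ, mul_pow]
    | succ k ih =>
      have h1 := h.nash_step_dyadic hθ hc₁ hc₂ hN hC₀ hC₀1 hδ hKm k (hτ0 k) (hspos (k + 1))
      rw [← hτs] at h1
      set p := profile θ (2 * C₀ * s (k + 1)) with hp
      have hp' : p = profile θ ((l - 1) * (l ^ (k + 1 + 1))⁻¹ * (2 * C₀ * T)) := by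
        rw [hp]
        congr 1
        simp only [hs]
        ring
      have hp0 : 0 < p := hp' ▸ hprof (k + 1)
      have e1 : X (k + 1) = X k + (K (2 ^ (k + 1)) + δ) * s (k + 1) := by
        simp only [hX]
        rw [Finset.sum_Icc_succ_top (by omega)]
        ring
      have e2 : Q (k + 1) = Q k * p ^ ((1 : ℝ) / 2 ^ (k + 1)) := by
        simp only [hQ]
        rw [Finset.prod_Icc_succ_top (by omega), hp']
      have e3 : √(p ^ ((1 : ℝ) / 2 ^ (k + 1))) ^ 2 ^ (k + 2) = p := by
        rw [pow_succ 2 (k + 1), mul_comm (2 ^ (k + 1)) 2, pow_mul,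
          Real.sq_sqrt (Real.rpow_nonneg hp0.le _), ← Real.rpow_natCast, ← Real.rpow_mul hp0.le]
        push_cast
        rw [one_div, inv_mul_cancel₀ (by positivity), Real.rpow_one]
      refine h1.trans ?_
      calc _ ≤ Real.exp ((K (2 ^ (k + 1)) + δ) * s (k + 1)) ^ 2 ^ (k + 2)
            * ((Real.exp (X k) * √(Q k) * F) ^ 2 ^ (k + 1)) ^ 2 * p := by
            have := h.orbitPow_nonneg (2 ^ (k + 1)) (τ k)
            gcongr
        _ = Real.exp ((K (2 ^ (k + 1)) + δ) * s (k + 1)) ^ 2 ^ (k + 2)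
            * (Real.exp (X k) * √(Q k) * F) ^ 2 ^ (k + 2)
            * √(p ^ ((1 : ℝ) / 2 ^ (k + 1))) ^ 2 ^ (k + 2) := by
            rw [e3, ← pow_mul, ← pow_succ]
        _ = _ := by
            rw [← mul_pow, ← mul_pow, e1, e2, Real.exp_add (X k), Real.sqrt_mul (hQ0 k)]
            congr 1
            ring
  -- From `τ k` to the common time `T` no smoothing is used, only growth at the exponent reached.
  have hfinal : ∀ k : ℕ, orbitPow P ψ g (2 ^ (k + 1)) T
      ≤ (Real.exp (((1 + ε) * K 1 + δ) * T) * √(Q k) * F) ^ 2 ^ (k + 1) := by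
    intro k
    have hτT : τ k ≤ T := by
      simp only [hτ]
      have : 0 ≤ T * (l ^ (k + 1))⁻¹ := by positivity
      linarith
    have h1 := h.growth_dyadic k (hτ0 k) hτT
    have h2 : T - τ k = T * (l ^ (k + 1))⁻¹ := by simp only [hτ]; ring
    have h3 := sum_rate_le hK0 hKm hKd hl hq hδ hT.le k
    calc _ ≤ _ := h1
      _ ≤ Real.exp (K (2 ^ k) * (T - τ k)) ^ 2 ^ (k + 1)
          * (Real.exp (X k) * √(Q k) * F) ^ 2 ^ (k + 1) := by
          gcongr
          exact claim k
      _ = (Real.exp (K (2 ^ k) * (T - τ k) + X k) * √(Q k) * F) ^ 2 ^ (k + 1) := by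
          rw [← mul_pow, Real.exp_add _ (X k)]
          congr 1
          ring
      _ ≤ _ := by
          gcongr
          rw [h2]
          exact h3
  have hmax : max T 0 = T := max_eq_left hT.le
  refine ae_le_of_integral_pow_le (f := fun x => Real.exp (ψ x) * P T g x)
    (b := fun k => Real.exp (((1 + ε) * K 1 + δ) * T) * √(Q k) * F) ?_ ?_ ?_ ?_ ?_
  · simpa only [hmax] using h.orbit_nonneg T
  · intro k
    positivity
  · exact ((hL.sqrt).const_mul _).mul_const _
  · intro k
    have h2 : 2 ^ (k + 1) = (2 ^ (k + 1) - 2) + 2 := by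
      have : 2 ≤ 2 ^ (k + 1) := by
        rw [pow_succ]
        have := Nat.one_le_two_pow (n := k)
        omega
      omega
    rw [h2]
    simpa only [hmax] using h.integrable (2 ^ (k + 1) - 2) T
  · intro k
    have := hfinal k
    rw [orbitPow, hmax] at this
    exact this

end DaviesOrbit

end OffDiag

/-! ### Positivity, truncation and multiplication by `e^ψ`. -/

namespace OffDiag

variable {E : Type*} [MeasurableSpace E] {m : Measure E} {P : ℝ → Lp ℝ 2 m →L[ℝ] Lp ℝ 2 m}

lemma Lp.integrableOn_of_measure_lt_top (f : Lp ℝ 2 m) {s : Set E} (hs : m s ≠ ⊤) :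
    IntegrableOn f s m := by
  have : IsFiniteMeasure (m.restrict s) := ⟨by simpa using hs.lt_top⟩
  exact ((Lp.memLp f).restrict s).integrable (by norm_num)

lemma Lp.ae_le_of_forall_inner [SigmaFinite m] {f : Lp ℝ 2 m} {M : ℝ}
    (h : ∀ (s : Set E) (hs : MeasurableSet s) (hμ : m s ≠ ⊤),
      inner ℝ (indicatorConstLp 2 hs hμ (1 : ℝ)) f ≤ M * m.real s) : ∀ᵐ x ∂m, f x ≤ M := by
  have h1 := ae_nonneg_of_forall_setIntegral_nonneg_of_sigmaFinite (μ := m)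
    (f := fun x => M - f x)
    (fun s _ hμ => (integrableOn_const hμ.ne).sub (Lp.integrableOn_of_measure_lt_top f hμ.ne))
    (fun s hs hμ => by
      have hc : Integrable (fun _ => M) (m.restrict s) := integrableOn_const hμ.ne
      have hf : Integrable f (m.restrict s) := Lp.integrableOn_of_measure_lt_top f hμ.ne
      rw [integral_sub hc hf, setIntegral_const]
      have := h s hs hμ.ne
      rw [L2.inner_indicatorConstLp_one] at this
      rw [smul_eq_mul]
      linarith)
  filter_upwards [h1] with x hx
  simp only [Pi.zero_apply] at hx
  linarith

lemma Lp.ae_nonneg_of_forall_inner [SigmaFinite m] {f : Lp ℝ 2 m}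
    (h : ∀ (s : Set E) (hs : MeasurableSet s) (hμ : m s ≠ ⊤),
      0 ≤ inner ℝ (indicatorConstLp 2 hs hμ (1 : ℝ)) f) : ∀ᵐ x ∂m, 0 ≤ f x := by
  have h1 := Lp.ae_le_of_forall_inner (f := -f) (M := 0) fun s hs hμ => by
    rw [inner_neg_right]
    have := h s hs hμ
    linarith
  filter_upwards [h1, Lp.coeFn_neg f] with x hx hx2
  rw [hx2, Pi.neg_apply] at hx
  linarith

lemma inner_nonneg_of_ae {f g : Lp ℝ 2 m} (hf : ∀ᵐ x ∂m, 0 ≤ f x) (hg : ∀ᵐ x ∂m, 0 ≤ g x) :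
    0 ≤ inner ℝ f g := by
  rw [inner_eq_integral]
  refine integral_nonneg_of_ae ?_
  filter_upwards [hf, hg] with x h1 h2 using mul_nonneg h1 h2

lemma ae_nonneg_indicator {s : Set E} (hs : MeasurableSet s) (hμ : m s ≠ ⊤) :
    ∀ᵐ x ∂m, 0 ≤ indicatorConstLp 2 hs hμ (1 : ℝ) x ∧ indicatorConstLp 2 hs hμ (1 : ℝ) x ≤ 1 := by
  filter_upwards [indicatorConstLp_coeFn (p := 2) (hs := hs) (hμs := hμ) (c := (1 : ℝ))] with x hx
  rw [hx]
  by_cases hz : x ∈ s <;> simp [hz]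

lemma ae_nonneg_inner_le {f g : Lp ℝ 2 m} {M : ℝ} (hf : ∀ᵐ x ∂m, 0 ≤ f x)
    (hfi : Integrable f m) (hg : ∀ᵐ x ∂m, g x ≤ M) : inner ℝ f g ≤ M * ∫ x, f x ∂m := by
  rw [inner_eq_integral, ← integral_const_mul]
  refine integral_mono_ae ((Lp.memLp f).integrable_mul (Lp.memLp g)) (hfi.const_mul M) ?_
  filter_upwards [hf, hg] with x h1 h2
  rw [mul_comm M]
  exact mul_le_mul_of_nonneg_left h2 h1

/-- A closed property of nonnegative functions holds once it holds for the bounded ones. -/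
lemma Lp.nonneg_induction {p : Lp ℝ 2 m → Prop} (hclosed : IsClosed {f | p f})
    (hbdd : ∀ f : Lp ℝ 2 m, (∃ M > 0, ∀ᵐ x ∂m, 0 ≤ f x ∧ f x ≤ M) → p f) (f : Lp ℝ 2 m)
    (hf : ∀ᵐ x ∂m, 0 ≤ f x) : p f := by
  have h0 : 0 ≤ f := (Lp.coeFn_nonneg f).1 hf
  refine (Lp.simpleFunc.denseRange_coeSimpleFuncNonnegToLpNonneg 2 m ℝ (by norm_num)).induction_on
    (p := fun g : {g : Lp ℝ 2 m // 0 ≤ g} => p g) ⟨f, h0⟩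
    (hclosed.preimage continuous_subtype_val) ?_
  rintro ⟨g, hg⟩
  obtain ⟨M, hM⟩ := (Lp.simpleFunc.toSimpleFunc g).exists_forall_norm_le
  have hg0 := (Lp.simpleFunc.coeFn_nonneg g).2 hg
  refine hbdd _ ⟨max M 1, lt_max_of_lt_right one_pos, ?_⟩
  filter_upwards [Lp.simpleFunc.toSimpleFunc_eq_toFun g, hg0] with x h1 h2
  refine ⟨h2, ?_⟩
  change (g : Lp ℝ 2 m) x ≤ _
  rw [← h1]
  exact ((le_abs_self _).trans (hM x)).trans (le_max_left _ _)

/-- The Markov property covers bounded functions, after scaling; density of simple functions gives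
the unbounded ones. -/
lemma IsMarkovSemigroup.apply_nonneg [SigmaFinite m] (hP : IsMarkovSemigroup P) {t : ℝ}
    (ht : 0 ≤ t) (f : Lp ℝ 2 m) (hf : ∀ᵐ x ∂m, 0 ≤ f x) : ∀ᵐ x ∂m, 0 ≤ P t f x := by
  refine Lp.ae_nonneg_of_forall_inner fun s hs hμ => ?_
  refine Lp.nonneg_induction (p := fun f =>
    0 ≤ inner ℝ (indicatorConstLp 2 hs hμ (1 : ℝ)) (P t f)) ?_ ?_ f hf
  · exact isClosed_le continuous_const (continuous_const.inner (P t).continuous)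
  · rintro f ⟨M, hM, hfM⟩
    exact inner_nonneg_of_ae ((ae_nonneg_indicator hs hμ).mono fun x hx => hx.1)
      ((hP.apply_mem_Icc ht hM hfM).mono fun x hx => hx.1)

/-- Pointwise bounds pass through the Bochner integral by testing against indicators of sets of
finite measure. -/
lemma IsMarkovSemigroup.orbitMean_mem_Icc [SigmaFinite m] (hP : IsMarkovSemigroup P) {a : ℝ}
    (ha : 0 < a) {M : ℝ} (hM : 0 < M) {f : Lp ℝ 2 m} (hf : ∀ᵐ x ∂m, 0 ≤ f x ∧ f x ≤ M) :
    ∀ᵐ x ∂m, 0 ≤ orbitMean P a f x ∧ orbitMean P a f x ≤ M := by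
  have hs : ∀ s : ℝ, ∀ᵐ x ∂m, 0 ≤ P (max s 0) f x ∧ P (max s 0) f x ≤ M := fun s =>
    hP.apply_mem_Icc (le_max_right _ _) hM hf
  have h1 : ∀ᵐ x ∂m, 0 ≤ orbitMean P a f x := by
    refine Lp.ae_nonneg_of_forall_inner fun s hsm hμ => ?_
    rw [hP.inner_orbitMean]
    refine mul_nonneg (inv_pos.2 ha).le (intervalIntegral.integral_nonneg ha.le fun r _ => ?_)
    exact inner_nonneg_of_ae ((ae_nonneg_indicator hsm hμ).mono fun x hx => hx.1)
      ((hs r).mono fun x hx => hx.1)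
  have h2 : ∀ᵐ x ∂m, orbitMean P a f x ≤ M := by
    refine Lp.ae_le_of_forall_inner fun s hsm hμ => ?_
    rw [hP.inner_orbitMean, inv_mul_le_iff₀ ha]
    have h3 : ∫ r in (0 : ℝ)..a, inner ℝ (indicatorConstLp 2 hsm hμ (1 : ℝ)) (P (max r 0) f)
        ≤ ∫ r in (0 : ℝ)..a, M * m.real s := by
      refine intervalIntegral.integral_mono_on ha.le
        ((continuous_const.inner (hP.continuous_path f)).intervalIntegrable _ _)
        (continuous_const.intervalIntegrable _ _) fun r _ => ?_
      rw [L2.inner_indicatorConstLp_one, mul_comm, ← smul_eq_mul, ← setIntegral_const]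
      exact integral_mono_ae (Lp.integrableOn_of_measure_lt_top _ hμ) (integrableOn_const hμ)
        (ae_restrict_of_ae ((hs r).mono fun x hx => hx.2))
    rw [intervalIntegral.integral_const, sub_zero, smul_eq_mul] at h3
    exact h3
  filter_upwards [h1, h2] with x h3 h4 using ⟨h3, h4⟩

section Multiplication

/-- The essential boundedness of a function of class `L²`. -/
def EssBdd (ψ : Lp ℝ 2 m) : Prop := ∃ K : ℝ, ∀ᵐ x ∂m, |ψ x| ≤ K

variable {ψ : Lp ℝ 2 m}

lemma EssBdd.neg (hψ : EssBdd ψ) : EssBdd (-ψ) := by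
  obtain ⟨K, hK⟩ := hψ
  refine ⟨K, ?_⟩
  filter_upwards [hK, Lp.coeFn_neg ψ] with x h1 h2
  rwa [h2, Pi.neg_apply, abs_neg]

lemma EssBdd.norm_exp_mul_le (hψ : EssBdd ψ) {p : ENNReal} (f : Lp ℝ p m) :
    ∀ᵐ x ∂m, ‖Real.exp (ψ x) * f x‖ ≤ Real.exp hψ.choose * ‖f x‖ := by
  filter_upwards [hψ.choose_spec] with x hx
  rw [norm_mul, Real.norm_eq_abs, Real.abs_exp]
  have := Real.exp_le_exp.2 (le_of_abs_le hx)
  gcongr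

lemma EssBdd.memLp_exp_mul (hψ : EssBdd ψ) {p : ENNReal} (f : Lp ℝ p m) :
    MemLp (fun x => Real.exp (ψ x) * f x) p m :=
  (Lp.memLp f).of_le_mul
    ((Real.continuous_exp.comp_aestronglyMeasurable (Lp.aestronglyMeasurable ψ)).mul
      (Lp.aestronglyMeasurable f)) (hψ.norm_exp_mul_le f)

/-- Multiplication by `e^ψ` on `L^p`. -/
def mulExp (p : ENNReal) [Fact (1 ≤ p)] (hψ : EssBdd ψ) : Lp ℝ p m →L[ℝ] Lp ℝ p m :=
  LinearMap.mkContinuous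
    { toFun := fun f => (hψ.memLp_exp_mul f).toLp _
      map_add' := fun f g => by
        refine Lp.ext ?_
        filter_upwards [(hψ.memLp_exp_mul (f + g)).coeFn_toLp, (hψ.memLp_exp_mul f).coeFn_toLp,
          (hψ.memLp_exp_mul g).coeFn_toLp, Lp.coeFn_add f g,
          Lp.coeFn_add ((hψ.memLp_exp_mul f).toLp _) ((hψ.memLp_exp_mul g).toLp _)]
          with x h1 h2 h3 h4 h5
        rw [h1, h5, Pi.add_apply, h2, h3, h4, Pi.add_apply]
        ring
      map_smul' := fun c f => by
        refine Lp.ext ?_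
        filter_upwards [(hψ.memLp_exp_mul (c • f)).coeFn_toLp, (hψ.memLp_exp_mul f).coeFn_toLp,
          Lp.coeFn_smul c f, Lp.coeFn_smul c ((hψ.memLp_exp_mul f).toLp _)] with x h1 h2 h3 h4
        rw [h1, RingHom.id_apply, h4, Pi.smul_apply, h2, h3, Pi.smul_apply]
        simp only [smul_eq_mul]
        ring }
    (Real.exp hψ.choose) fun f => by
      refine Lp.norm_le_mul_norm_of_ae_le_mul ?_
      filter_upwards [(hψ.memLp_exp_mul f).coeFn_toLp, hψ.norm_exp_mul_le f] with x h1 h2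
      change ‖((hψ.memLp_exp_mul f).toLp _ : Lp ℝ p m) x‖ ≤ _
      rw [h1]
      exact h2

lemma coeFn_mulExp (p : ENNReal) [Fact (1 ≤ p)] (hψ : EssBdd ψ) (f : Lp ℝ p m) :
    ∀ᵐ x ∂m, mulExp p hψ f x = Real.exp (ψ x) * f x :=
  (hψ.memLp_exp_mul f).coeFn_toLp

lemma mulExp_mulExp_neg (p : ENNReal) [Fact (1 ≤ p)] (hψ : EssBdd ψ) (f : Lp ℝ p m) :
    mulExp p hψ (mulExp p hψ.neg f) = f := by
  refine Lp.ext ?_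
  filter_upwards [coeFn_mulExp p hψ (mulExp p hψ.neg f), coeFn_mulExp p hψ.neg f,
    Lp.coeFn_neg ψ] with x h1 h2 h3
  rw [h1, h2, h3, Pi.neg_apply, ← mul_assoc, ← Real.exp_add]
  simp

lemma mulExp_neg_mulExp (p : ENNReal) [Fact (1 ≤ p)] (hψ : EssBdd ψ) (f : Lp ℝ p m) :
    mulExp p hψ.neg (mulExp p hψ f) = f := by
  refine Lp.ext ?_
  filter_upwards [coeFn_mulExp p hψ f, coeFn_mulExp p hψ.neg (mulExp p hψ f),
    Lp.coeFn_neg ψ] with x h1 h2 h3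
  rw [h2, h1, h3, Pi.neg_apply, ← mul_assoc, ← Real.exp_add]
  simp

lemma inner_mulExp_left (hψ : EssBdd ψ) (f g : Lp ℝ 2 m) :
    inner ℝ (mulExp 2 hψ f) g = inner ℝ f (mulExp 2 hψ g) := by
  rw [inner_eq_integral, inner_eq_integral]
  refine integral_congr_ae ?_
  filter_upwards [coeFn_mulExp 2 hψ f, coeFn_mulExp 2 hψ g] with x h1 h2
  rw [h1, h2]
  ring

lemma mulExp_nonneg (p : ENNReal) [Fact (1 ≤ p)] (hψ : EssBdd ψ) {f : Lp ℝ p m}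
    (hf : ∀ᵐ x ∂m, 0 ≤ f x) : ∀ᵐ x ∂m, 0 ≤ mulExp p hψ f x := by
  filter_upwards [coeFn_mulExp p hψ f, hf] with x h1 h2
  rw [h1]
  exact mul_nonneg (Real.exp_pos _).le h2

end Multiplication

end OffDiag

/-! ### Duality and extension of the semigroup to `L¹`. -/

namespace OffDiag

variable {E : Type*} [MeasurableSpace E] {m : Measure E} {P : ℝ → Lp ℝ 2 m →L[ℝ] Lp ℝ 2 m}
  {ψ : Lp ℝ 2 m}

/-- The operator `e^ψ P_t` maps `L²` (with the weight `e^ψ`) to `L^∞`, with norm at most `B`; here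
tested against nonnegative integrable functions. -/
def SupBound (P : ℝ → Lp ℝ 2 m →L[ℝ] Lp ℝ 2 m) (t : ℝ) (hψ : EssBdd ψ) (B : ℝ) : Prop :=
  ∀ f χ : Lp ℝ 2 m, (∀ᵐ x ∂m, 0 ≤ f x) → (∀ᵐ x ∂m, 0 ≤ χ x) → Integrable χ m →
    inner ℝ χ (mulExp 2 hψ (P t f)) ≤ B * ‖mulExp 2 hψ f‖ * ∫ x, χ x ∂m

section Davies

variable {D : DirichletForm m} {C₀ : ℝ} {K : ℝ → ℝ} {θ : ℝ → ℝ} {δ c₁ c₂ l₀ : ℝ} {cl Cl : ℝ → ℝ}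

/-- The pointwise bound holds for bounded data in the generator domain. In the tested form both
sides are continuous in `f`, so it passes from orbit means to bounded functions and then to all
nonnegative ones. -/
lemma supBound_of_daviesBound [SigmaFinite m] (hP : IsMarkovSemigroup P) (hD : IsAssociated D P)
    (hψD : ψ ∈ D.bddDom) (hψ : EssBdd ψ) (hDB : D.DaviesBound C₀ K ψ)
    (hθ : ThetaConditions θ c₁ c₂ l₀ cl Cl) (hc₁ : 1 ≤ c₁) (hc₂ : 1 ≤ c₂) (hN : D.Nash θ δ)
    (hC₀ : 0 < C₀) (hC₀1 : C₀ ≤ 1) (hδ : 0 ≤ δ) (hK0 : ∀ r, 1 ≤ r → 0 ≤ K r)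
    (hKm : MonotoneOn K (Ici 1)) {C η ε l : ℝ} (hKd : ∀ R, 1 ≤ R → K R ≤ C * R ^ η * K 1)
    (hl : 2 ≤ l) (hq : ∀ n : ℕ, ∑ j ∈ Finset.Icc 1 n, C * ((2 : ℝ) ^ η / l) ^ j ≤ ε)
    {T L : ℝ} (hT : 0 < T)
    (hL : Tendsto (fun n : ℕ => ∏ k ∈ Finset.Icc 1 n,
      profile θ ((l - 1) * (l ^ (k + 1))⁻¹ * (2 * C₀ * T)) ^ ((1 : ℝ) / 2 ^ k)) atTop (𝓝 L)) :
    SupBound P T hψ (Real.exp (((1 + ε) * K 1 + δ) * T) * √L) := by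
  set B := Real.exp (((1 + ε) * K 1 + δ) * T) * √L with hB
  intro f χ hf hχ hχi
  have hcl : IsClosed {f : Lp ℝ 2 m |
      inner ℝ χ (mulExp 2 hψ (P T f)) ≤ B * ‖mulExp 2 hψ f‖ * ∫ x, χ x ∂m} := by
    refine isClosed_le ?_ ?_
    · exact continuous_const.inner ((mulExp 2 hψ).continuous.comp (P T).continuous)
    · exact (continuous_const.mul (mulExp 2 hψ).continuous.norm).mul continuous_const
  refine Lp.nonneg_induction (p := fun f =>
    inner ℝ χ (mulExp 2 hψ (P T f)) ≤ B * ‖mulExp 2 hψ f‖ * ∫ x, χ x ∂m) hcl ?_ f hf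
  rintro f ⟨M, hM, hfM⟩
  refine hcl.mem_of_tendsto (hP.tendsto_orbitMean f) ?_
  filter_upwards [self_mem_nhdsWithin] with a ha
  have ha : 0 < a := ha
  have horb : DaviesOrbit D P C₀ K ψ (orbitMean P a f) :=
    ⟨hP, hD, hψD, hDB, hC₀.le, ⟨_, hP.tendsto_generator_orbitMean ha f⟩,
      ⟨M, hM, hP.orbitMean_mem_Icc ha hM hfM⟩⟩
  have hle := horb.ae_le hθ hc₁ hc₂ hN hC₀ hC₀1 hδ hK0 hKm hKd hl hq hT hL
  have hnorm : √(orbitPow P ψ (orbitMean P a f) 2 0) = ‖mulExp 2 hψ (orbitMean P a f)‖ := by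
    rw [← Real.sqrt_sq (norm_nonneg (mulExp 2 hψ (orbitMean P a f))), norm_sq_eq_integral]
    congr 1
    refine integral_congr_ae ?_
    filter_upwards [coeFn_mulExp 2 hψ (orbitMean P a f)] with x hx
    rw [hx, max_self, hP.zero_apply]
  rw [hnorm] at hle
  refine ae_nonneg_inner_le hχ hχi ?_
  filter_upwards [hle, coeFn_mulExp 2 hψ (P T (orbitMean P a f))] with x h1 h2
  rw [h2]
  exact h1

end Davies

section Duality

variable [SigmaFinite m]

/-- The dual `L¹ → L²` bound, by testing on the output `k` itself: `‖k‖² = ⟨φ, e^ψ P_t e^(-ψ) k⟩ ≤ B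
‖k‖ ∫ φ`. The sign of `ψ` is reversed. -/
lemma SupBound.norm_le (hP : IsMarkovSemigroup P) {t : ℝ} (ht : 0 ≤ t) {hψ : EssBdd ψ} {B : ℝ}
    (hB : 0 ≤ B) (h : SupBound P t hψ B) {φ : Lp ℝ 2 m} (hφ : ∀ᵐ x ∂m, 0 ≤ φ x)
    (hφi : Integrable φ m) :
    ‖mulExp 2 hψ.neg (P t (mulExp 2 hψ φ))‖ ≤ B * ∫ x, φ x ∂m := by
  set k := mulExp 2 hψ.neg (P t (mulExp 2 hψ φ)) with hk
  have hk0 : ∀ᵐ x ∂m, 0 ≤ k x :=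
    mulExp_nonneg 2 hψ.neg (hP.apply_nonneg ht _ (mulExp_nonneg 2 hψ hφ))
  have h1 := h (mulExp 2 hψ.neg k) φ (mulExp_nonneg 2 hψ.neg hk0) hφ hφi
  rw [mulExp_mulExp_neg, ← inner_mulExp_left, ← hP.inner_apply_left ht, ← inner_mulExp_left,
    ← hk, real_inner_self_eq_norm_sq] at h1
  have hI : 0 ≤ ∫ x, φ x ∂m := integral_nonneg_of_ae hφ
  by_contra! hcon
  have hk1 : 0 < ‖k‖ := lt_of_le_of_lt (mul_nonneg hB hI) hcon
  nlinarith

/-- Writing `P_{2t} = P_t P_t` and moving one factor across, the pairing is that of `e^(-ψ) P_t e^ψ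
χ` with `e^ψ P_t e^(-ψ) φ`; Cauchy–Schwarz and the two dual bounds finish. This is why both signs of
`ψ` are needed. -/
lemma SupBound.inner_le (hP : IsMarkovSemigroup P) {t : ℝ} (ht : 0 ≤ t) {hψ : EssBdd ψ} {B : ℝ}
    (hB : 0 ≤ B) (h : SupBound P t hψ B) (h' : SupBound P t hψ.neg B) {φ χ : Lp ℝ 2 m}
    (hφ : ∀ᵐ x ∂m, 0 ≤ φ x) (hφi : Integrable φ m) (hχ : ∀ᵐ x ∂m, 0 ≤ χ x)
    (hχi : Integrable χ m) :
    inner ℝ χ (mulExp 2 hψ (P (t + t) (mulExp 2 hψ.neg φ)))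
      ≤ B ^ 2 * (∫ x, χ x ∂m) * ∫ x, φ x ∂m := by
  have e1 : inner ℝ χ (mulExp 2 hψ (P (t + t) (mulExp 2 hψ.neg φ)))
      = inner ℝ (mulExp 2 hψ.neg (P t (mulExp 2 hψ χ)))
          (mulExp 2 hψ (P t (mulExp 2 hψ.neg φ))) := by
    rw [inner_mulExp_left, mulExp_neg_mulExp, hP.inner_apply_left ht, inner_mulExp_left,
      hP.apply_apply ht ht]
  have hψψ : mulExp 2 hψ.neg.neg (P t (mulExp 2 hψ.neg φ))
      = mulExp 2 hψ (P t (mulExp 2 hψ.neg φ)) := by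
    simp only [neg_neg]
  have h1 := h.norm_le hP ht hB hχ hχi
  have h2 := h'.norm_le hP ht hB hφ hφi
  rw [hψψ] at h2
  rw [e1]
  calc _ ≤ _ := real_inner_le_norm _ _
    _ ≤ (B * ∫ x, χ x ∂m) * (B * ∫ x, φ x ∂m) :=
        mul_le_mul h1 h2 (norm_nonneg _) (mul_nonneg hB (integral_nonneg_of_ae hχ))
    _ = _ := by ring

end Duality

section Extension

lemma ae_nonneg_abs_sub (f : Lp ℝ 2 m) : ∀ᵐ x ∂m, 0 ≤ (|f| - f) x := by
  filter_upwards [Lp.coeFn_sub |f| f, Lp.coeFn_abs f] with x h1 h2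
  rw [h1, Pi.sub_apply, h2]
  exact sub_nonneg.2 (le_abs_self _)

lemma ae_nonneg_abs (f : Lp ℝ 2 m) : ∀ᵐ x ∂m, 0 ≤ |f| x := by
  filter_upwards [Lp.coeFn_abs f] with x h2
  rw [h2]
  exact abs_nonneg _

lemma IsMarkovSemigroup.abs_apply_le [SigmaFinite m] (hP : IsMarkovSemigroup P) {t : ℝ} (ht : 0 ≤ t)
    (f : Lp ℝ 2 m) : ∀ᵐ x ∂m, |P t f x| ≤ P t |f| x := by
  have h1 := hP.apply_nonneg ht _ (ae_nonneg_abs_sub f)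
  have h2 := hP.apply_nonneg ht _ (ae_nonneg_abs_sub (-f))
  rw [map_sub] at h1 h2
  rw [map_neg, abs_neg, sub_neg_eq_add] at h2
  filter_upwards [h1, h2, Lp.coeFn_sub (P t |f|) (P t f), Lp.coeFn_add (P t |f|) (P t f)]
    with x h3 h4 h5 h6
  rw [h5, Pi.sub_apply] at h3
  rw [h6, Pi.add_apply] at h4
  exact abs_le.2 ⟨by linarith, by linarith⟩

/-- The semigroup contracts the `L¹` norm on `L¹ ∩ L²`. -/
lemma IsMarkovSemigroup.integrable_apply [SigmaFinite m] (hP : IsMarkovSemigroup P) {t : ℝ} (ht : 0 ≤ t)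
    {f : Lp ℝ 2 m} (hf : Integrable f m) :
    Integrable (P t f) m ∧ ∫ x, |P t f x| ∂m ≤ ∫ x, |f x| ∂m := by
  have hI : 0 ≤ ∫ x, |f x| ∂m := integral_nonneg fun x => abs_nonneg _
  have hfabs : Integrable (|f| : Lp ℝ 2 m) m := by
    refine hf.abs.congr ?_
    filter_upwards [Lp.coeFn_abs f] with x hx using hx.symm
  have hbound : ∫⁻ x, ENNReal.ofReal |P t f x| ∂m ≤ ENNReal.ofReal (∫ x, |f x| ∂m) := by
    refine lintegral_le_of_forall_fin_meas_le _ fun s hs hμ => ?_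
    have hint := (Lp.integrableOn_of_measure_lt_top (P t f) hμ).abs
    rw [← ofReal_integral_eq_lintegral_ofReal hint (ae_of_all _ fun x => abs_nonneg _)]
    refine ENNReal.ofReal_le_ofReal ?_
    calc ∫ x in s, |P t f x| ∂m ≤ ∫ x in s, P t |f| x ∂m :=
          integral_mono_ae hint (Lp.integrableOn_of_measure_lt_top _ hμ)
            (ae_restrict_of_ae (hP.abs_apply_le ht f))
      _ = inner ℝ |f| (P t (indicatorConstLp 2 hs hμ (1 : ℝ))) := by
          rw [← L2.inner_indicatorConstLp_one (𝕜 := ℝ) hs hμ, ← hP.inner_apply_left ht,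
            real_inner_comm]
      _ ≤ 1 * ∫ x, |f| x ∂m :=
          ae_nonneg_inner_le (ae_nonneg_abs f) hfabs
            ((hP.markov t ht _ (ae_nonneg_indicator hs hμ)).mono fun x hx => hx.2)
      _ = ∫ x, |f x| ∂m := by
          rw [one_mul]
          exact integral_congr_ae (Lp.coeFn_abs f)
  have hint : Integrable (P t f) m := by
    refine ⟨Lp.aestronglyMeasurable _, ?_⟩
    rw [hasFiniteIntegral_iff_norm]
    exact hbound.trans_lt ENNReal.ofReal_lt_top
  refine ⟨hint, ?_⟩
  rw [← ofReal_integral_eq_lintegral_ofReal hint.abs (ae_of_all _ fun x => abs_nonneg _)] at hbound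
  exact (ENNReal.ofReal_le_ofReal_iff hI).1 hbound

/-- The integrable elements of `L²`. -/
def integrableL2 (m : Measure E) : Submodule ℝ (Lp ℝ 2 m) where
  carrier := {f | Integrable f m}
  add_mem' := fun {f g} hf hg => (hf.add hg).congr (Lp.coeFn_add f g).symm
  zero_mem' := (integrable_zero E ℝ m).congr (Lp.coeFn_zero ℝ 2 m).symm
  smul_mem' := fun c f hf => (hf.smul c).congr (Lp.coeFn_smul c f).symm

/-- The inclusion of `L¹ ∩ L²` into `L¹`. -/
def integrableL2ToL1 (m : Measure E) : integrableL2 m →ₗ[ℝ] Lp ℝ 1 m where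
  toFun := fun f => Integrable.toL1 _ f.2
  map_add' := fun f g => by
    refine Lp.ext ?_
    filter_upwards [Integrable.coeFn_toL1 (f + g).2, Integrable.coeFn_toL1 f.2,
      Integrable.coeFn_toL1 g.2, Lp.coeFn_add (f : Lp ℝ 2 m) g,
      Lp.coeFn_add (Integrable.toL1 _ f.2) (Integrable.toL1 _ g.2)] with x h1 h2 h3 h4 h5
    rw [h1, h5, Pi.add_apply, h2, h3, Submodule.coe_add, h4, Pi.add_apply]
  map_smul' := fun c f => by
    refine Lp.ext ?_
    filter_upwards [Integrable.coeFn_toL1 (c • f).2, Integrable.coeFn_toL1 f.2,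
      Lp.coeFn_smul c (f : Lp ℝ 2 m), Lp.coeFn_smul c (Integrable.toL1 _ f.2)] with x h1 h2 h3 h4
    rw [h1, RingHom.id_apply, h4, Pi.smul_apply, h2, Submodule.coe_smul, h3, Pi.smul_apply]

lemma coeFn_integrableL2ToL1 (f : integrableL2 m) :
    integrableL2ToL1 m f =ᵐ[m] (f : Lp ℝ 2 m) := Integrable.coeFn_toL1 f.2

lemma norm_integrableL2ToL1 (f : integrableL2 m) :
    ‖integrableL2ToL1 m f‖ = ∫ x, |(f : Lp ℝ 2 m) x| ∂m := by
  rw [L1.norm_eq_integral_norm]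
  refine integral_congr_ae ?_
  filter_upwards [coeFn_integrableL2ToL1 f] with x hx
  rw [hx, Real.norm_eq_abs]

lemma denseRange_integrableL2ToL1 : DenseRange (integrableL2ToL1 m) := by
  refine (Lp.simpleFunc.denseRange (E := ℝ) (μ := m) (p := 1) (by norm_num)).mono ?_
  rintro _ ⟨f, rfl⟩
  have h1 : MemLp (Lp.simpleFunc.toSimpleFunc f) 1 m := Lp.simpleFunc.memLp f
  have h2 : MemLp (Lp.simpleFunc.toSimpleFunc f) 2 m :=
    (SimpleFunc.memLp_iff (by norm_num) (by norm_num)).2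
      ((SimpleFunc.memLp_iff (by norm_num) (by norm_num)).1 h1)
  have hi : Integrable (h2.toLp _ : Lp ℝ 2 m) m :=
    (memLp_one_iff_integrable.1 h1).congr h2.coeFn_toLp.symm
  refine ⟨⟨h2.toLp _, hi⟩, Lp.ext ?_⟩
  filter_upwards [coeFn_integrableL2ToL1 (⟨h2.toLp _, hi⟩ : integrableL2 m), h2.coeFn_toLp,
    Lp.simpleFunc.toSimpleFunc_eq_toFun f] with x h3 h4 h5
  rw [h3, h4, h5]

/-- A symmetric Markov semigroup extends to `L¹`. -/
lemma IsMarkovSemigroup.exists_l1Extension [SigmaFinite m] (hP : IsMarkovSemigroup P) {t : ℝ}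
    (ht : 0 ≤ t) : ∃ Q : Lp ℝ 1 m →L[ℝ] Lp ℝ 1 m, IsL1Extension (P t) Q := by
  have hmem : ∀ f ∈ integrableL2 m, (P t : Lp ℝ 2 m →ₗ[ℝ] Lp ℝ 2 m) f ∈ integrableL2 m :=
    fun f hf => (hP.integrable_apply ht hf).1
  set S : integrableL2 m →ₗ[ℝ] Lp ℝ 1 m :=
    (integrableL2ToL1 m).comp ((P t : Lp ℝ 2 m →ₗ[ℝ] Lp ℝ 2 m).restrict hmem) with hS
  have hnorm : ∃ C : ℝ, ∀ f, ‖S f‖ ≤ C * ‖integrableL2ToL1 m f‖ := by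
    refine ⟨1, fun f => ?_⟩
    rw [one_mul, norm_integrableL2ToL1, hS, LinearMap.comp_apply, norm_integrableL2ToL1]
    exact (hP.integrable_apply ht f.2).2
  refine ⟨S.extendOfNorm (integrableL2ToL1 m), fun f g hfg => ?_⟩
  have hf : Integrable f m := (L1.integrable_coeFn g).congr hfg.symm
  have hg : g = integrableL2ToL1 m ⟨f, hf⟩ := by
    refine Lp.ext ?_
    filter_upwards [hfg, coeFn_integrableL2ToL1 (⟨f, hf⟩ : integrableL2 m)] with x h1 h2
    rw [h2, ← h1]
  rw [hg, LinearMap.extendOfNorm_eq denseRange_integrableL2ToL1 hnorm]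
  exact (coeFn_integrableL2ToL1 (m := m)
    ((P t : Lp ℝ 2 m →ₗ[ℝ] Lp ℝ 2 m).restrict hmem ⟨f, hf⟩)).symm

end Extension

end OffDiag

/-! ### The perturbed operator from `L¹` to `L^∞`. -/

namespace OffDiag

variable {E : Type*} [MeasurableSpace E] {m : Measure E} {P : ℝ → Lp ℝ 2 m →L[ℝ] Lp ℝ 2 m}
  {ψ : Lp ℝ 2 m}

/-- The bound for the perturbed semigroup on `L¹ ∩ L²`, for functions of any sign. -/
lemma SupBound.setIntegral_le [SigmaFinite m] (hP : IsMarkovSemigroup P) {t : ℝ} (ht : 0 ≤ t)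
    {hψ : EssBdd ψ} {B : ℝ} (hB : 0 ≤ B) (h : SupBound P t hψ B) (h' : SupBound P t hψ.neg B)
    {φ : Lp ℝ 2 m} (hφ : Integrable φ m) {s : Set E} (hs : MeasurableSet s) (hμ : m s ≠ ⊤) :
    ∫ x in s, mulExp 2 hψ (P (t + t) (mulExp 2 hψ.neg φ)) x ∂m
      ≤ B ^ 2 * m.real s * ∫ x, |φ x| ∂m := by
  set e := indicatorConstLp 2 hs hμ (1 : ℝ) with he
  have he0 : ∀ᵐ x ∂m, 0 ≤ e x := (ae_nonneg_indicator hs hμ).mono fun x hx => hx.1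
  have hei : Integrable e m := by
    refine ((integrable_indicator_iff hs).2 (integrableOn_const (C := (1 : ℝ)) hμ)).congr ?_
    exact indicatorConstLp_coeFn.symm
  have hee : ∫ x, e x ∂m = m.real s := by
    rw [integral_congr_ae (indicatorConstLp_coeFn (p := 2) (hs := hs) (hμs := hμ) (c := (1 : ℝ))),
      integral_indicator hs, setIntegral_const]
    simp
  have hφabs : Integrable (|φ| : Lp ℝ 2 m) m := by
    refine hφ.abs.congr ?_
    filter_upwards [Lp.coeFn_abs φ] with x hx using hx.symm
  have h1 := h.inner_le hP ht hB h' (ae_nonneg_abs φ) hφabs he0 hei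
  -- Positivity of the perturbed operator reduces `φ` to `|φ|`.
  have h2 : 0 ≤ inner ℝ e (mulExp 2 hψ (P (t + t) (mulExp 2 hψ.neg (|φ| - φ)))) :=
    inner_nonneg_of_ae he0 (mulExp_nonneg 2 hψ (hP.apply_nonneg (by positivity) _
      (mulExp_nonneg 2 hψ.neg (ae_nonneg_abs_sub φ))))
  simp only [map_sub, inner_sub_right] at h2
  rw [hee, integral_congr_ae (Lp.coeFn_abs φ)] at h1
  rw [← L2.inner_indicatorConstLp_one (𝕜 := ℝ) hs hμ]
  linarith

/-- The perturbed operator is bounded from `L¹` to `L^∞`. -/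
lemma exists_isPerturbed [SigmaFinite m] (hP : IsMarkovSemigroup P) {t : ℝ} (ht : 0 ≤ t)
    {hψ : EssBdd ψ} {B : ℝ} (hB : 0 ≤ B) (h : SupBound P t hψ B) (h' : SupBound P t hψ.neg B) :
    ∃ T : Lp ℝ 1 m →L[ℝ] Lp ℝ ⊤ m, IsPerturbed (P (t + t)) ψ T ∧ ‖T‖ ≤ B ^ 2 := by
  obtain ⟨Q, hQ⟩ := hP.exists_l1Extension (add_nonneg ht ht)
  set S : Lp ℝ 1 m →L[ℝ] Lp ℝ 1 m := (mulExp 1 hψ).comp (Q.comp (mulExp 1 hψ.neg)) with hS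
  -- Set integrals are continuous on `L¹`, so the bound on the dense subspace `L¹ ∩ L²` extends;
  -- varying the set and using both `f` and `-f` gives the essential bound.
  have hSet : ∀ (s : Set E), MeasurableSet s → m s ≠ ⊤ → ∀ f : Lp ℝ 1 m,
      ∫ x in s, S f x ∂m ≤ B ^ 2 * m.real s * ‖f‖ := by
    intro s hs hμ f
    refine denseRange_integrableL2ToL1.induction_on
      (p := fun f : Lp ℝ 1 m => ∫ x in s, S f x ∂m ≤ B ^ 2 * m.real s * ‖f‖) f ?_ ?_
    · exact isClosed_le ((continuous_setIntegral s).comp S.continuous)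
        (continuous_const.mul continuous_norm)
    · intro φ
      have hae : ∀ᵐ x ∂m, S (integrableL2ToL1 m φ) x
          = mulExp 2 hψ (P (t + t) (mulExp 2 hψ.neg (φ : Lp ℝ 2 m))) x := by
        have hh : mulExp 2 hψ.neg (φ : Lp ℝ 2 m)
            =ᵐ[m] mulExp 1 hψ.neg (integrableL2ToL1 m φ) := by
          filter_upwards [coeFn_mulExp 2 hψ.neg (φ : Lp ℝ 2 m),
            coeFn_mulExp 1 hψ.neg (integrableL2ToL1 m φ), coeFn_integrableL2ToL1 φ]
            with x h1 h2 h3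
          rw [h1, h2, h3]
        filter_upwards [hQ _ _ hh,
          coeFn_mulExp 2 hψ (P (t + t) (mulExp 2 hψ.neg (φ : Lp ℝ 2 m))),
          coeFn_mulExp 1 hψ (Q (mulExp 1 hψ.neg (integrableL2ToL1 m φ)))] with x h1 h2 h3
        rw [h2, h1]
        exact h3
      rw [integral_congr_ae (ae_restrict_of_ae hae), norm_integrableL2ToL1]
      exact h.setIntegral_le hP ht hB h' φ.2 hs hμ
  have hle : ∀ f : Lp ℝ 1 m, ∀ᵐ x ∂m, S f x ≤ B ^ 2 * ‖f‖ := by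
    intro f
    have hi : Integrable (S f) m := L1.integrable_coeFn _
    have h1 := ae_nonneg_of_forall_setIntegral_nonneg_of_sigmaFinite (μ := m)
      (f := fun x => B ^ 2 * ‖f‖ - S f x)
      (fun s _ hμ => (integrableOn_const hμ.ne).sub hi.integrableOn)
      (fun s hs hμ => by
        have hc : Integrable (fun _ => B ^ 2 * ‖f‖) (m.restrict s) := integrableOn_const hμ.ne
        rw [integral_sub hc hi.integrableOn, setIntegral_const, smul_eq_mul]
        have := hSet s hs hμ.ne f
        linarith)
    filter_upwards [h1] with x hx
    exact sub_nonneg.1 hx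
  have hbound : ∀ f : Lp ℝ 1 m, ∀ᵐ x ∂m, ‖S f x‖ ≤ B ^ 2 * ‖f‖ := by
    intro f
    have h2 := hle (-f)
    rw [map_neg, norm_neg] at h2
    filter_upwards [hle f, h2, Lp.coeFn_neg (S f)] with x h3 h4 h5
    rw [h5, Pi.neg_apply] at h4
    exact abs_le.2 ⟨by linarith, h3⟩
  have hmem : ∀ f : Lp ℝ 1 m, MemLp (S f) ⊤ m := fun f =>
    memLp_top_of_bound (Lp.aestronglyMeasurable _) _ (hbound f)
  set T : Lp ℝ 1 m →L[ℝ] Lp ℝ ⊤ m := LinearMap.mkContinuous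
    { toFun := fun f => (hmem f).toLp _
      map_add' := fun f g => by
        refine Lp.ext ?_
        filter_upwards [(hmem (f + g)).coeFn_toLp, (hmem f).coeFn_toLp, (hmem g).coeFn_toLp,
          Lp.coeFn_add (S f) (S g), Lp.coeFn_add ((hmem f).toLp _) ((hmem g).toLp _)]
          with x h1 h2 h3 h4 h5
        rw [h1, h5, Pi.add_apply, h2, h3, map_add, h4, Pi.add_apply]
      map_smul' := fun c f => by
        refine Lp.ext ?_
        filter_upwards [(hmem (c • f)).coeFn_toLp, (hmem f).coeFn_toLp,
          Lp.coeFn_smul c (S f), Lp.coeFn_smul c ((hmem f).toLp _)] with x h1 h2 h3 h4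
        rw [h1, RingHom.id_apply, h4, Pi.smul_apply, h2, map_smul, h3, Pi.smul_apply] }
    (B ^ 2) (fun f => by
      change ‖(hmem f).toLp _‖ ≤ _
      rw [Lp.norm_toLp, eLpNorm_exponent_top]
      exact ENNReal.toReal_le_of_le_ofReal (by positivity)
        (eLpNormEssSup_le_of_ae_bound (hbound f))) with hT
  refine ⟨T, ⟨Q, hQ, fun f h hh => ?_⟩, LinearMap.mkContinuous_norm_le _ (sq_nonneg B) _⟩
  have hh' : h = mulExp 1 hψ.neg f := by
    refine Lp.ext ?_
    filter_upwards [hh, coeFn_mulExp 1 hψ.neg f, Lp.coeFn_neg ψ] with x h1 h2 h3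
    rw [h1, h2, h3, Pi.neg_apply]
  have hTf : ∀ᵐ x ∂m, T f x = S f x := (hmem f).coeFn_toLp
  filter_upwards [hTf, coeFn_mulExp 1 hψ (Q (mulExp 1 hψ.neg f))] with x h1 h2
  rw [h1, hh', ← h2]
  rfl

lemma DirichletForm.DaviesBound.mono {D : DirichletForm m} {C₀ C₁ : ℝ} {K : ℝ → ℝ}
    (h : D.DaviesBound C₀ K ψ) (hC : C₁ ≤ C₀) : D.DaviesBound C₁ K ψ := by
  intro p hp f hf hf0 u v w hu hv hw
  refine le_trans ?_ (h p hp f hf hf0 u v w hu hv hw)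
  have hp0 : 0 < p := by linarith
  have := D.nonneg w
  gcongr

/-- Evenness of the rate is known only for exponents `≥ 1`, which are the only ones the bound sees;
it puts `ψ` and `-ψ` under the same rate. -/
lemma DirichletForm.DaviesBound.congr_rate {D : DirichletForm m} {C₀ : ℝ} {K K' : ℝ → ℝ}
    (h : D.DaviesBound C₀ K ψ) (hK : ∀ r, 1 ≤ r → K r = K' r) : D.DaviesBound C₀ K' ψ := by
  intro p hp f hf hf0 u v w hu hv hw
  rw [← hK p hp]
  exact h p hp f hf hf0 u v w hu hv hw

end OffDiag

end

theorem proposition4p4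
    (c₁ c₂ l₀ : ℝ) (cl Cl : ℝ → ℝ) (C η ε : ℝ)
    (hc₁ : 1 ≤ c₁) (hc₂ : 1 ≤ c₂) (hl₀ : 2 ≤ l₀)
    (hcl : ∀ l > l₀, 0 < cl l) (hCl : ∀ l > l₀, 0 < Cl l)
    (hC : 1 ≤ C) (hη : 0 < η) (hε : 0 < ε) :
    ∃ Cε > 0, ∀ C₀ > 0, ∃ cε > 0,
      ∀ (E : Type*) [MetricSpace E] [LocallyCompactSpace E] [TopologicalSpace.SeparableSpace E]
        [MeasurableSpace E] [BorelSpace E]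
        (m : Measure E) [SigmaFinite m] [m.Regular] [m.IsOpenPosMeasure]
        (D : DirichletForm m) (P : ℝ → Lp ℝ 2 m →L[ℝ] Lp ℝ 2 m) (θ : ℝ → ℝ) (δ : ℝ)
        (Φ : Lp ℝ 2 m → ℝ → ℝ),
        D.Regular → IsMarkovSemigroup P → IsAssociated D P → 0 ≤ δ →
        ThetaConditions θ c₁ c₂ l₀ cl Cl → D.Nash θ δ →
        ∀ ψ ∈ D.Admissible C₀ Φ C η, ∀ t > 0,
          ∃ T : Lp ℝ 1 m →L[ℝ] Lp ℝ ⊤ m, IsPerturbed (P t) ψ T ∧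
            ‖T‖ ≤ Cε * profile θ (cε * t) * Real.exp (δ * t) *
              Real.exp ((1 + ε) * Φ ψ 1 * t) := by
  obtain ⟨l, hl, hq⟩ := exists_step_ratio C η ε l₀ hC hε hl₀
  -- `l` was fixed from `C`, `η`, `ε`, `l₀` alone, so this constant does not depend on `C₀`.
  refine ⟨Cl l, hCl l hl, fun C₀ hC₀ => ?_⟩
  -- Lowering `C₀` only weakens the Davies bound, and `C₁ ≤ 1` keeps the contribution of `δ` at
  -- `e^(δt)`.
  set C₁ := min C₀ 1 with hC₁
  have hC₁0 : 0 < C₁ := lt_min hC₀ one_pos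
  refine ⟨cl l * C₁, mul_pos (hcl l hl) hC₁0, ?_⟩
  intro E _ _ _ _ _ m _ _ _ D P θ δ Φ _ hP hD hδ hθ hN ψ hψ t ht
  obtain ⟨hψD, hrate, hDB, hDB'⟩ := hψ
  have hψb : EssBdd ψ := hψD.2
  have hψD' : -ψ ∈ D.bddDom := ⟨D.dom.neg_mem hψD.1, hψb.neg⟩
  obtain ⟨L, hL, hLle⟩ := hθ.product l hl (C₁ * t) (by positivity)
  have hl2 : 2 ≤ l := by linarith
  -- Each half of the factorisation runs for time `t/2`; the factor `2` in `2 C₁ T` restores the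
  -- argument `C₁ t` at which condition (iii) was invoked.
  set T := t / 2 with hT
  have hT0 : 0 < T := by positivity
  have hTC : C₁ * t = 2 * C₁ * T := by rw [hT]; ring
  rw [hTC] at hL
  have hKd : ∀ R, 1 ≤ R → Φ ψ R ≤ C * R ^ η * Φ ψ 1 := fun R hR => by
    simpa using hrate.doubling ψ hψD 1 R le_rfl hR
  set B := Real.exp (((1 + ε) * Φ ψ 1 + δ) * T) * √L with hB
  have hplus : SupBound P T hψb B := supBound_of_daviesBound hP hD hψD hψb
    (hDB.mono (min_le_left C₀ 1)) hθ hc₁ hc₂ hN hC₁0 (min_le_right _ _) hδ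
    (hrate.nonneg ψ hψD) (hrate.mono ψ hψD) hKd hl2 hq hT0 hL
  have hminus : SupBound P T hψb.neg B := supBound_of_daviesBound hP hD hψD' hψb.neg
    ((hDB'.mono (min_le_left C₀ 1)).congr_rate (hrate.even ψ hψD)) hθ hc₁ hc₂ hN hC₁0
    (min_le_right _ _) hδ (hrate.nonneg ψ hψD) (hrate.mono ψ hψD) hKd hl2 hq hT0 hL
  obtain ⟨S, hS, hSn⟩ := exists_isPerturbed hP hT0.le (by positivity) hplus hminus
  have htt : T + T = t := by rw [hT]; ring
  rw [htt] at hS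
  refine ⟨S, hS, hSn.trans ?_⟩
  have hL0 : 0 ≤ L := ge_of_tendsto' hL fun n => Finset.prod_nonneg fun k _ =>
    Real.rpow_nonneg (hθ.profile_spec hc₁ hc₂ (by
      have : 0 < l - 1 := by linarith
      positivity)).1.le _
  have hB2 : B ^ 2 = L * (Real.exp (δ * t) * Real.exp ((1 + ε) * Φ ψ 1 * t)) := by
    rw [hB, mul_pow, Real.sq_sqrt hL0, ← Real.exp_nat_mul, ← Real.exp_add, mul_comm]
    congr 2
    rw [hT]
    push_cast
    ring
  rw [hB2, mul_assoc _ (Real.exp (δ * t))]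
  refine mul_le_mul_of_nonneg_right ?_ (by positivity)
  rw [mul_assoc (cl l)]
  exact hLle
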